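/- Let $3<p<5$ and consider the defocusing wave equation $$\partial_t^2 u-\Delta u=-|u|^{p-1}u\qquad\text{on }\{(x,t)\in\mathbb R^3\times\mathbb R:\ |x|>|t|\}.\qquad(*)$$ For $R>0$ let $\mathcal H_R$ be the space of restrictions to $\{|x|>R\}$ of elements of $\dot H^1(\mathbb R^3)\times L^2(\mathbb R^3)$. A function $u$ is an *$R$-weakly non-radiative solution* with initial data $(u_0,u_1)\in\mathcal H_R$ if * $u\in L^{\frac{2p}{p-3}}\big(I;L^{2p}(\{x:|x|>|t|+R\})\big)$ for every bounded closed interval $I\subset\mathbb R$; * $u=\mathbf S_L(t)(u_0,u_1)-\int_0^t\frac{\sin((t-\tau)\sqrt{-\Delta})}{\sqrt{-\Delta}}\,\chi_R\,|u|^{p-1}u(\cdot,\tau)\,d\tau$ for $|x|>|t|+R$, where $\chi_R$ is the characteristic function of $\{|x|>|t|+R\}$ and $\mathbf S_L(t)(u_0,u_1)=\cos(t\sqrt{-\Delta})u_0+\frac{\sin(t\sqrt{-\Delta})}{\sqrt{-\Delta}}u_1$, the data being extended to $\dot H^1\times L^2(\mathbb R^3)$ in any way; * $\displaystyle\lim_{t\to\pm\infty}\int_{|x|>|t|+R}\big(|\nabla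 u(x,t)|^2+|u_t(x,t)|^2\big)\,dx=0.$ Then there is a radial (in $x$) function $u\in C^2(\{|x|>|t|\})$ that solves $(*)$ classically, has initial data $(u,u_t)|_{t=0}=(0,u_1)$ on $\mathbb R^3\setminus\{0\}$ with $u_1\not\equiv0$, and is an $R$-weakly non-radiative solution for every $R>0$. Its data are orthogonal to $(1/|x|,0)$ for every $R>0$, that is, $$\int_{|x|>R}\Big(\nabla u(x,0)\cdot\nabla\tfrac1{|x|}+u_1(x)\cdot 0\Big)dx=0 .$$ Moreover $u$ can be taken of the form $u(x,t)=|x|^{-\beta}f(t/|x|)$ with $\beta=\frac2{p-1}$, where, for some $a>0$, $f\in C^2((-1,1))$ solves $$(1-y^2)f''(y)-2\beta yf'(y)+\beta(1-\beta)f(y)+|f(y)|^{p-1}f(y)=0\quad(-1<y<1),\qquad f(0)=0,\ f'(0)=a.$$ -/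

import Mathlib

open MeasureTheory Metric Filter Topology
open scoped ENNReal ContDiff Laplacian Gradient

noncomputable section

/-- Euclidean three-space. -/
abbrev E3 : Type := EuclideanSpace ℝ (Fin 3)

/-- The slice `{x : |x| > |t| + R}` at time `t` of the exterior region. -/
def extSlice (R t : ℝ) : Set E3 := {x | |t| + R < ‖x‖}

/-- The exterior region `{(x,t) : |x| > |t| + R}` of space-time (time is the first coordinate). -/
def extRegion (R : ℝ) : Set (ℝ × E3) := {z | |z.1| + R < ‖z.2‖}

/-- The power nonlinearity `F(y) = ζ |y|^(p-1) y`; `ζ = -1` is the defocusing case and `ζ = 1` the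
focusing one. -/
def powerNL (p ζ y : ℝ) : ℝ := ζ * |y| ^ (p - 1) * y

/-- `u` is a classical solution of `∂ₜ²u - Δu = ζ |u|^(p-1) u` that is `C²` on the exterior region
`{|x| > |t| + R}`. -/
structure IsC2Solution (p ζ R : ℝ) (u : ℝ → E3 → ℝ) : Prop where
  contDiffOn : ContDiffOn ℝ 2 (Function.uncurry u) (extRegion R)
  equation : ∀ (t : ℝ) (x : E3), |t| + R < ‖x‖ →
    iteratedDeriv 2 (fun s => u s x) t - Δ (u t) x = powerNL p ζ (u t x)

/-- `u` is radial in `x` on the exterior region `{|x| > |t| + R}`. -/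
def IsRadialOn (R : ℝ) (u : ℝ → E3 → ℝ) : Prop :=
  ∀ (t : ℝ) (x y : E3), |t| + R < ‖x‖ → ‖x‖ = ‖y‖ → u t x = u t y

/-- `G` is the weak gradient of `v` on `ℝ³`. -/
def IsWeakGradient (v : E3 → ℝ) (G : E3 → E3) : Prop :=
  ∀ φ : E3 → ℝ, ContDiff ℝ ∞ φ → HasCompactSupport φ → ∀ e : E3,
    ∫ x, v x * fderiv ℝ φ x e = -∫ x, inner ℝ (G x) e * φ x

/-- `v ∈ Ḣ¹(ℝ³)` with gradient `G`: in dimension three the homogeneous Sobolev space consists of the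
functions in `L⁶` that have a weak gradient in `L²`. -/
structure IsHdot1 (v : E3 → ℝ) (G : E3 → E3) : Prop where
  memLp : MemLp v 6 volume
  memLp_grad : MemLp G 2 volume
  weakGradient : IsWeakGradient v G

/-- The pair `(v₀, v₁) ∈ Ḣ¹(ℝ³) × L²(ℝ³)`, where `v₀` has weak gradient `G`, coincides with
`(u₀, u₁)` on `{|x| > R}`. -/
structure IsEnergyExtension (R : ℝ) (u₀ u₁ v₀ : E3 → ℝ) (G : E3 → E3) (v₁ : E3 → ℝ) : Prop where
  hdot1 : IsHdot1 v₀ G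
  memLp : MemLp v₁ 2 volume
  eq_left : ∀ᵐ x : E3, R < ‖x‖ → v₀ x = u₀ x
  eq_right : ∀ᵐ x : E3, R < ‖x‖ → v₁ x = u₁ x

/-- `(u₀, u₁) ∈ ℋ_R`, the space of restrictions to `{|x| > R}` of elements of
`Ḣ¹(ℝ³) × L²(ℝ³)`. -/
def MemHR (R : ℝ) (u₀ u₁ : E3 → ℝ) : Prop :=
  ∃ (v₀ : E3 → ℝ) (G : E3 → E3) (v₁ : E3 → ℝ), IsEnergyExtension R u₀ u₁ v₀ G v₁

/-- The pairing of `ℋ_{rad,R}`, for data whose first components are differentiable on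
`{|x| > R}`. -/
def pairingHR (R : ℝ) (u₀ u₁ v₀ v₁ : E3 → ℝ) : ℝ :=
  ∫ x in {x : E3 | R < ‖x‖}, (inner ℝ (∇ u₀ x) (∇ v₀ x) + u₁ x * v₁ x)

/-- The mean of `h` over the unit sphere of `ℝ³` with respect to surface measure. -/
def sphereMean (h : E3 → ℝ) : ℝ :=
  ⨍ θ : sphere (0 : E3) 1, h (θ : E3) ∂((volume : Measure E3).toSphere)

/-- The operator `sin(s√-Δ)/√-Δ` on `ℝ³`: convolution with `(4πs)⁻¹` times surface measure of the
sphere of radius `|s|`, i.e. `s` times the mean of `g` over the sphere of radius `|s|` about `x`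
(defined for almost every `x` when `g` is locally integrable). -/
def sinProp (s : ℝ) (g : E3 → ℝ) (x : E3) : ℝ :=
  s * sphereMean (fun θ => g (x + s • θ))

/-- The operator `cos(s√-Δ)` on `ℝ³`, the `s`-derivative of `sin(s√-Δ)/√-Δ`, applied to a function
`g` with (weak) gradient `G`. -/
def cosProp (s : ℝ) (g : E3 → ℝ) (G : E3 → E3) (x : E3) : ℝ :=
  sphereMean (fun θ => g (x + s • θ) + s * inner ℝ (G (x + s • θ)) θ)

/-- The linear propagator `S_L(t)(v₀, v₁) = cos(t√-Δ) v₀ + (sin(t√-Δ)/√-Δ) v₁`, where `G` is the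
gradient of `v₀`. -/
def linProp (t : ℝ) (v₀ : E3 → ℝ) (G : E3 → E3) (v₁ : E3 → ℝ) (x : E3) : ℝ :=
  cosProp t v₀ G x + sinProp t v₁ x

/-- The Duhamel term `∫₀ᵗ (sin((t-τ)√-Δ)/√-Δ) χ_R F(u)(τ) dτ`, where `χ_R` is the characteristic
function of the exterior region. -/
def duhamel (p ζ R : ℝ) (u : ℝ → E3 → ℝ) (t : ℝ) (x : E3) : ℝ :=
  ∫ τ in (0 : ℝ)..t,
    sinProp (t - τ) ((extSlice R τ).indicator (fun y => powerNL p ζ (u τ y))) x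

/-- `u ∈ X(I) = L^{2p/(p-3)}(I; L^{2p}({|x| > |t| + R}))`. -/
def MemX (p R : ℝ) (I : Set ℝ) (u : ℝ → E3 → ℝ) : Prop :=
  AEStronglyMeasurable (Function.uncurry u)
      (volume.restrict (extRegion R ∩ {z : ℝ × E3 | z.1 ∈ I})) ∧
    ∫⁻ t in I, (eLpNorm (u t) (ENNReal.ofReal (2 * p)) (volume.restrict (extSlice R t)))
      ^ (2 * p / (p - 3)) < ⊤

/-- `u` is an exterior solution, defined for all times, of `∂ₜ²u - Δu = ζ |u|^(p-1) u` in
`{|x| > |t| + R}` with initial data `(u₀, u₁) ∈ ℋ_R`: it lies in `X(I)` for every bounded closed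
interval `I` and satisfies the Duhamel formula in the exterior region.  By finite speed of
propagation the extension of the data to `{|x| ≤ R}` does not matter. -/
structure IsExteriorSolution (p ζ R : ℝ) (u₀ u₁ : E3 → ℝ) (u : ℝ → E3 → ℝ) : Prop where
  memX : ∀ a b : ℝ, MemX p R (Set.Icc a b) u
  duhamel_eq : ∃ (v₀ : E3 → ℝ) (G : E3 → E3) (v₁ : E3 → ℝ),
    IsEnergyExtension R u₀ u₁ v₀ G v₁ ∧
      ∀ t : ℝ, ∀ᵐ x : E3, |t| + R < ‖x‖ → u t x = linProp t v₀ G v₁ x + duhamel p ζ R u t x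

/-- The integral `∫_{|x| > |t| + R} |∇_{x,t} u(x,t)|² dx`, with values in `[0, ∞]`. -/
def extEnergy (R : ℝ) (u : ℝ → E3 → ℝ) (t : ℝ) : ℝ≥0∞ :=
  ∫⁻ x in extSlice R t, (‖∇ (u t) x‖ₑ ^ 2 + ‖deriv (fun s => u s x) t‖ₑ ^ 2)

/-- `u` is an `R`-weakly non-radiative solution, continuously differentiable on
`{|x| > |t| + R}`, with initial data `(u₀, u₁) ∈ ℋ_R`. -/
structure IsWeaklyNonRadiative (p ζ R : ℝ) (u₀ u₁ : E3 → ℝ) (u : ℝ → E3 → ℝ) : Prop where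
  contDiffOn : ContDiffOn ℝ 1 (Function.uncurry u) (extRegion R)
  memHR : MemHR R u₀ u₁
  exterior : IsExteriorSolution p ζ R u₀ u₁ u
  tendsto_atTop : Tendsto (extEnergy R u) atTop (𝓝 0)
  tendsto_atBot : Tendsto (extEnergy R u) atBot (𝓝 0)

/-- `f ∈ C²((-1,1))` solves
`(1-y²) f'' - 2β y f' + β(1-β) f + |f|^(p-1) f = 0` on `(-1,1)`, `f(0) = 0`, `f'(0) = a`, with
`β = 2/(p-1)`. -/
structure IsProfile (p a : ℝ) (f : ℝ → ℝ) : Prop where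
  contDiffOn : ContDiffOn ℝ 2 f (Set.Ioo (-1) 1)
  equation : ∀ y ∈ Set.Ioo (-1 : ℝ) 1,
    (1 - y ^ 2) * iteratedDeriv 2 f y - 2 * (2 / (p - 1)) * y * deriv f y
      + 2 / (p - 1) * (1 - 2 / (p - 1)) * f y + |f y| ^ (p - 1) * f y = 0
  init : f 0 = 0
  init_deriv : deriv f 0 = a

end

/-! For `u = |x|^(-β) f(t/|x|)` the wave equation becomes the profile equation, which is singular at
`y = ±1`. With `m = β(1-β) f + |f|^(p-1) f` it reads `((1-y²)^β f')' = -(1-y²)^(β-1) m`, so `f'`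
generically blows up like `(1-y)^(-β)` at the light cone, which would leave energy in `|x| > |t| +
R` for all times. The solutions with bounded `f'` are those with no boundary term at `y = 1`, that
is `f' = profileFlux β m`. For them `|∇u|² + |u_t|²` is at most a constant times `|x|^(-2β-2)`. This
is integrable at infinity because `β > 1/2`, i.e. `p < 5`, and the exterior energy tends to zero by
dominated convergence.

It remains to find a regular profile that also vanishes at `y = 0`. The equation is solved backwards
from the cone: with `f = κφ`, `φ(1) = 1` and `μ = κ^(p-1)`, the function `φ` solves a Volterra
equation, and `φ(0)` depends continuously on `μ` (`exists_continuousOn_volterra`). At `μ = 0` one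
has `φ(0) > 0`. For large `μ` the nonlinear flux forces `φ(0) ≤ 0`; here `β < 1`, i.e. `p > 3`, is
needed. The intermediate value theorem gives a zero (`exists_volterra_zero`), and odd reflection
gives the profile on `(-1,1)` (`exists_bounded_odd_profile`).

The Duhamel formula is checked by reduction to one dimension. Archimedes' theorem
(`toSphere_map_inner`) turns spherical means of radial functions into interval integrals
(`sinProp_radial`), and `|x| u` satisfies d'Alembert's formula outside the cone
(`selfSimilar_dAlembert`). All domains of dependence stay in `|x| > |t| + R`, so neither the cutoff
nor the extension of the data matters. -/

/-! ### The flux operator, which inverts the first-order part of the profile equation. -/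

/-- The weight `(1 - σ²)^(β-1)`, in factored form. -/
noncomputable def profileWeight (β σ : ℝ) : ℝ := (1 - σ) ^ (β - 1) * (1 + σ) ^ (β - 1)

/-- `(1 - s²)^(-β) ∫ₛ¹ (1 - σ²)^(β-1) m(σ) dσ`. -/
noncomputable def profileFlux (β : ℝ) (m : ℝ → ℝ) (s : ℝ) : ℝ :=
  (1 - s) ^ (-β) * (1 + s) ^ (-β) * ∫ σ in s..1, profileWeight β σ * m σ

lemma intervalIntegrable_one_sub_rpow {β : ℝ} (hβ : 0 < β) (a b : ℝ) :
    IntervalIntegrable (fun σ : ℝ => (1 - σ) ^ (β - 1)) volume a b := by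
  have h := (intervalIntegral.intervalIntegrable_rpow' (a := 1 - a) (b := 1 - b)
    (r := β - 1) (by linarith)).comp_sub_left 1
  simpa using h

lemma integral_one_sub_rpow {β : ℝ} (hβ : 0 < β) (s : ℝ) :
    ∫ σ in s..1, (1 - σ) ^ (β - 1) = (1 - s) ^ β / β := by
  rw [intervalIntegral.integral_comp_sub_left (fun x : ℝ => x ^ (β - 1)) 1,
    integral_rpow (Or.inl (by linarith))]
  simp [Real.zero_rpow hβ.ne']

lemma intervalIntegrable_profileWeight_mul {β : ℝ} (hβ : 0 < β) {m : ℝ → ℝ} (hm : Continuous m)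
    {a b : ℝ} (ha : -1 < a) (hb : -1 < b) :
    IntervalIntegrable (fun σ => profileWeight β σ * m σ) volume a b := by
  have h : ContinuousOn (fun σ : ℝ => (1 + σ) ^ (β - 1) * m σ) (Set.uIcc a b) := by
    refine ContinuousOn.mul (ContinuousOn.rpow_const (by fun_prop) ?_) hm.continuousOn
    intro x hx
    have : min a b ≤ x := hx.1
    have : -1 < min a b := lt_min ha hb
    left; linarith
  refine ((intervalIntegrable_one_sub_rpow hβ a b).mul_continuousOn h).congr ?_
  intro σ _
  simp only [profileWeight]; ring

lemma profileWeight_nonneg {β σ : ℝ} (h1 : -1 ≤ σ) (h2 : σ ≤ 1) : 0 ≤ profileWeight β σ :=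
  mul_nonneg (Real.rpow_nonneg (by linarith) _) (Real.rpow_nonneg (by linarith) _)

lemma continuousAt_profileWeight {β σ : ℝ} (h1 : -1 < σ) (h2 : σ < 1) :
    ContinuousAt (profileWeight β) σ := by
  unfold profileWeight
  refine ContinuousAt.mul (ContinuousAt.rpow_const (by fun_prop) (Or.inl ?_))
    (ContinuousAt.rpow_const (by fun_prop) (Or.inl ?_)) <;> linarith

lemma measurable_profileWeight (β : ℝ) : Measurable (profileWeight β) := by
  unfold profileWeight; fun_prop

lemma hasDerivAt_integral_profileWeight {β : ℝ} (hβ : 0 < β) {m : ℝ → ℝ} (hm : Continuous m)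
    {s : ℝ} (h1 : -1 < s) (h2 : s < 1) :
    HasDerivAt (fun s => ∫ σ in s..1, profileWeight β σ * m σ) (-(profileWeight β s * m s)) s := by
  refine intervalIntegral.integral_hasDerivAt_left
    (intervalIntegrable_profileWeight_mul hβ hm h1 (by norm_num)) ?_
    ((continuousAt_profileWeight h1 h2).mul hm.continuousAt)
  exact ((measurable_profileWeight β).mul hm.measurable).stronglyMeasurable.stronglyMeasurableAtFilter

lemma rpow_neg_mul_profileWeight {β s : ℝ} (h1 : -1 < s) (h2 : s < 1) :
    (1 - s) ^ (-β) * (1 + s) ^ (-β) * profileWeight β s = 1 / (1 - s ^ 2) := by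
  have e1 : (1 - s) ^ (-β) * (1 - s) ^ (β - 1) = (1 - s)⁻¹ := by
    rw [← Real.rpow_add (by linarith), ← Real.rpow_neg_one]; ring_nf
  have e2 : (1 + s) ^ (-β) * (1 + s) ^ (β - 1) = (1 + s)⁻¹ := by
    rw [← Real.rpow_add (by linarith), ← Real.rpow_neg_one]; ring_nf
  calc _ = ((1 - s) ^ (-β) * (1 - s) ^ (β - 1)) * ((1 + s) ^ (-β) * (1 + s) ^ (β - 1)) := by
        unfold profileWeight; ring
    _ = _ := by
        rw [e1, e2]
        have : 1 - s ≠ 0 := by linarith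
        have : 1 + s ≠ 0 := by linarith
        have : 1 - s ^ 2 ≠ 0 := by
          rw [show 1 - s ^ 2 = (1 - s) * (1 + s) by ring]; positivity
        field_simp; ring

/-- The flux solves `(1 - s²) J' = 2βs J - m`. -/
lemma hasDerivAt_profileFlux {β : ℝ} (hβ : 0 < β) {m : ℝ → ℝ} (hm : Continuous m)
    {s : ℝ} (h1 : -1 < s) (h2 : s < 1) :
    HasDerivAt (profileFlux β m) ((2 * β * s * profileFlux β m s - m s) / (1 - s ^ 2)) s := by
  have d1 : HasDerivAt (fun s : ℝ => (1 - s) ^ (-β)) (-1 * (-β) * (1 - s) ^ (-β - 1)) s :=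
    ((hasDerivAt_id s).const_sub 1).rpow_const (Or.inl (by simp; linarith))
  have d2 : HasDerivAt (fun s : ℝ => (1 + s) ^ (-β)) (1 * (-β) * (1 + s) ^ (-β - 1)) s :=
    ((hasDerivAt_id s).const_add 1).rpow_const (Or.inl (by simp; linarith))
  have d3 := hasDerivAt_integral_profileWeight hβ hm h1 h2
  have d := (d1.mul d2).mul d3
  have hw := rpow_neg_mul_profileWeight (β := β) h1 h2
  refine d.congr_deriv ?_
  simp only [profileFlux, Pi.mul_apply]
  rw [Real.rpow_sub_one (by linarith), Real.rpow_sub_one (by linarith)]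
  generalize (∫ σ in s..1, profileWeight β σ * m σ) = I
  have e1 : 1 - s ≠ 0 := by linarith
  have e2 : 1 + s ≠ 0 := by linarith
  have e3 : 1 - s ^ 2 ≠ 0 := by
    rw [show 1 - s ^ 2 = (1 - s) * (1 + s) by ring]; positivity
  have : (1 - s) ^ (-β) * (1 + s) ^ (-β) * -(profileWeight β s * m s) = -(m s / (1 - s ^ 2)) := by
    rw [show (1 - s) ^ (-β) * (1 + s) ^ (-β) * -(profileWeight β s * m s)
      = -((1 - s) ^ (-β) * (1 + s) ^ (-β) * profileWeight β s * m s) by ring, hw]; ring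
  rw [this]
  generalize (1 - s) ^ (-β) = A
  generalize (1 + s) ^ (-β) = B
  rw [show 1 - s ^ 2 = (1 - s) * (1 + s) by ring]
  field_simp
  ring

lemma continuousAt_profileFlux {β : ℝ} (hβ : 0 < β) {m : ℝ → ℝ} (hm : Continuous m)
    {s : ℝ} (h1 : -1 < s) (h2 : s < 1) : ContinuousAt (profileFlux β m) s :=
  (hasDerivAt_profileFlux hβ hm h1 h2).continuousAt

lemma profileFlux_sub {β : ℝ} (hβ : 0 < β) {m n : ℝ → ℝ} (hm : Continuous m) (hn : Continuous n)
    {s : ℝ} (h1 : -1 < s) :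
    profileFlux β m s - profileFlux β n s = profileFlux β (fun σ => m σ - n σ) s := by
  simp only [profileFlux]
  rw [← mul_sub, ← intervalIntegral.integral_sub
    (intervalIntegrable_profileWeight_mul hβ hm h1 (by norm_num))
    (intervalIntegrable_profileWeight_mul hβ hn h1 (by norm_num))]
  simp only [mul_sub]

/-- For `β < 1` the factor `(1+σ)^(β-1)` is largest at `σ = s`, and the integral of `(1-σ)^(β-1)` is
`(1-s)^β / β`, which cancels the singular prefactor. This cancellation keeps the derivative of the
profile bounded up to the cone. -/
lemma abs_profileFlux_le {β : ℝ} (hβ : 0 < β) (hβ1 : β < 1) {m : ℝ → ℝ}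
    {s K : ℝ} (h1 : 0 ≤ s) (h2 : s < 1) (hK : ∀ σ ∈ Set.Icc s 1, |m σ| ≤ K) :
    |profileFlux β m s| ≤ K / (β * (1 + s)) := by
  have hK0 : 0 ≤ K := (abs_nonneg _).trans (hK s ⟨le_rfl, h2.le⟩)
  have p1 : 0 < (1 - s) ^ (-β) := Real.rpow_pos_of_pos (by linarith) _
  have p2 : 0 < (1 + s) ^ (-β) := Real.rpow_pos_of_pos (by linarith) _
  have hI : ‖∫ σ in s..1, profileWeight β σ * m σ‖
      ≤ ∫ σ in s..1, (1 - σ) ^ (β - 1) * ((1 + s) ^ (β - 1) * K) := by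
    refine intervalIntegral.norm_integral_le_of_norm_le h2.le (ae_of_all _ ?_)
      ((intervalIntegrable_one_sub_rpow hβ _ _).mul_const _)
    intro σ hσ
    have q1 : 0 ≤ (1 - σ) ^ (β - 1) := Real.rpow_nonneg (by linarith [hσ.2]) _
    have q2 : 0 ≤ (1 + σ) ^ (β - 1) := Real.rpow_nonneg (by linarith [hσ.1]) _
    have q3 : (1 + σ) ^ (β - 1) ≤ (1 + s) ^ (β - 1) :=
      Real.rpow_le_rpow_of_nonpos (by linarith) (by linarith [hσ.1]) (by linarith)
    rw [profileWeight, Real.norm_eq_abs, abs_mul, abs_mul, abs_of_nonneg q1, abs_of_nonneg q2,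
      mul_assoc]
    have := hK σ ⟨hσ.1.le, hσ.2⟩
    gcongr
  rw [intervalIntegral.integral_mul_const, integral_one_sub_rpow hβ, Real.norm_eq_abs] at hI
  rw [profileFlux, abs_mul, abs_mul, abs_of_pos p1, abs_of_pos p2]
  calc _ ≤ (1 - s) ^ (-β) * (1 + s) ^ (-β) * ((1 - s) ^ β / β * ((1 + s) ^ (β - 1) * K)) := by
        gcongr
    _ = _ := by
        rw [Real.rpow_sub_one (by linarith), Real.rpow_neg (by linarith), Real.rpow_neg (by linarith)]
        have a1 : (1 - s) ^ β ≠ 0 := (Real.rpow_pos_of_pos (by linarith) _).ne'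
        have a2 : (1 + s) ^ β ≠ 0 := (Real.rpow_pos_of_pos (by linarith) _).ne'
        have : 1 + s ≠ 0 := by linarith
        field_simp

lemma abs_profileFlux_le' {β : ℝ} (hβ : 0 < β) (hβ1 : β < 1) {m : ℝ → ℝ}
    {s K : ℝ} (h1 : 0 ≤ s) (h2 : s < 1) (hK : ∀ σ ∈ Set.Icc s 1, |m σ| ≤ K) :
    |profileFlux β m s| ≤ K / β := by
  have hK0 : 0 ≤ K := (abs_nonneg _).trans (hK s ⟨le_rfl, h2.le⟩)
  refine (abs_profileFlux_le hβ hβ1 h1 h2 hK).trans ?_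
  gcongr
  nlinarith

lemma profileFlux_nonneg {β : ℝ} {m : ℝ → ℝ} {s : ℝ} (h1 : 0 ≤ s) (h2 : s < 1)
    (hm : ∀ σ ∈ Set.Icc s 1, 0 ≤ m σ) : 0 ≤ profileFlux β m s := by
  refine mul_nonneg (mul_nonneg (Real.rpow_nonneg (by linarith) _)
    (Real.rpow_nonneg (by linarith) _)) ?_
  refine intervalIntegral.integral_nonneg h2.le fun σ hσ => mul_nonneg ?_ (hm σ hσ)
  exact profileWeight_nonneg (by linarith [hσ.1]) hσ.2

/-- Lower bound for the flux at points left of an interval on which `m` is large. -/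
lemma le_profileFlux {β : ℝ} (hβ : 0 < β) (hβ1 : β < 1) {m : ℝ → ℝ} (hc : Continuous m)
    {s r K : ℝ} (h1 : 0 ≤ s) (hsr : s ≤ r) (h2 : r < 1) (hm : ∀ σ ∈ Set.Icc s 1, 0 ≤ m σ)
    (hK : ∀ σ ∈ Set.Icc r 1, K ≤ m σ) (hK0 : 0 ≤ K) :
    (1 - r) ^ β * K / (4 * β) ≤ profileFlux β m s := by
  have i1 := intervalIntegrable_profileWeight_mul hβ hc (a := s) (b := r) (by linarith) (by linarith)
  have i2 := intervalIntegrable_profileWeight_mul hβ hc (a := r) (b := 1) (by linarith) (by norm_num)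
  have hI1 : 0 ≤ ∫ σ in s..r, profileWeight β σ * m σ :=
    intervalIntegral.integral_nonneg hsr fun σ hσ => mul_nonneg
      (profileWeight_nonneg (by linarith [hσ.1]) (by linarith [hσ.2]))
      (hm σ ⟨hσ.1, by linarith [hσ.2]⟩)
  have hI2 : ∫ σ in r..1, (1 - σ) ^ (β - 1) * (1 / 2 * K)
      ≤ ∫ σ in r..1, profileWeight β σ * m σ := by
    refine intervalIntegral.integral_mono_on h2.le
      ((intervalIntegrable_one_sub_rpow hβ _ _).mul_const _) i2 ?_
    intro σ hσ
    have q1 : 0 ≤ (1 - σ) ^ (β - 1) := Real.rpow_nonneg (by linarith [hσ.2]) _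
    -- This factor `1/2` and the one from `(1+s)^(-β)` below make the `4` in the denominator.
    have q3 : 1 / 2 ≤ (1 + σ) ^ (β - 1) := by
      have e1 : (2 : ℝ) ^ (β - 1) ≤ (1 + σ) ^ (β - 1) :=
        Real.rpow_le_rpow_of_nonpos (by linarith [hσ.1]) (by linarith [hσ.2]) (by linarith)
      have e2 : (2 : ℝ) ^ (-1 : ℝ) ≤ 2 ^ (β - 1) :=
        Real.rpow_le_rpow_of_exponent_le (by norm_num) (by linarith)
      rw [Real.rpow_neg_one] at e2
      linarith
    rw [profileWeight, mul_assoc]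
    have := hK σ hσ
    gcongr
  rw [intervalIntegral.integral_mul_const, integral_one_sub_rpow hβ] at hI2
  have hs := intervalIntegral.integral_add_adjacent_intervals i1 i2
  have p1 : 1 ≤ (1 - s) ^ (-β) := by
    rw [Real.rpow_neg (by linarith)]
    exact (one_le_inv₀ (Real.rpow_pos_of_pos (by linarith) _)).2
      (Real.rpow_le_one (by linarith) (by linarith) hβ.le)
  have p2 : 1 / 2 ≤ (1 + s) ^ (-β) := by
    have e1 : (2 : ℝ) ^ (-β) ≤ (1 + s) ^ (-β) :=
      Real.rpow_le_rpow_of_nonpos (by linarith) (by linarith) (by linarith)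
    have e2 : (2 : ℝ) ^ (-1 : ℝ) ≤ 2 ^ (-β) :=
      Real.rpow_le_rpow_of_exponent_le (by norm_num) (by linarith)
    rw [Real.rpow_neg_one] at e2
    linarith
  have p3 : 0 ≤ (1 - r) ^ β := Real.rpow_nonneg (by linarith) _
  have p4 : 0 ≤ (1 - r) ^ β / β * (1 / 2 * K) := by positivity
  rw [profileFlux, ← hs]
  calc (1 - r) ^ β * K / (4 * β) = 1 * (1 / 2) * ((1 - r) ^ β / β * (1 / 2 * K)) := by
        field_simp; ring
    _ ≤ _ := by
        gcongr
        linarith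

/-- The flux is continuous and bounded on the open interval. Its value at `1`, where the formula
degenerates to `0`, is irrelevant; later arguments likewise discard the point `1` as a null set. -/
lemma intervalIntegrable_profileFlux {β : ℝ} (hβ : 0 < β) (hβ1 : β < 1) {m : ℝ → ℝ}
    (hm : Continuous m) : IntervalIntegrable (profileFlux β m) volume 0 1 := by
  obtain ⟨K, hK⟩ := (isCompact_Icc (a := (0 : ℝ)) (b := 1)).exists_bound_of_continuousOn
    hm.continuousOn
  rw [intervalIntegrable_iff_integrableOn_Ioo_of_le zero_le_one]
  refine Integrable.of_bound (C := K / β) ?_ ?_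
  · refine ContinuousOn.aestronglyMeasurable (fun s hs => ?_) measurableSet_Ioo
    exact (continuousAt_profileFlux hβ hm (by linarith [hs.1]) hs.2).continuousWithinAt
  · filter_upwards [ae_restrict_mem (measurableSet_Ioo (a := (0 : ℝ)) (b := 1))] with s hs
    refine abs_profileFlux_le' hβ hβ1 hs.1.le hs.2 fun σ hσ => ?_
    exact hK σ ⟨by linarith [hσ.1, hs.1], hσ.2⟩

lemma intervalIntegrable_profileFlux_left {β : ℝ} (hβ : 0 < β) (hβ1 : β < 1) {m : ℝ → ℝ}
    (hm : Continuous m) {y : ℝ} (hy : y ∈ Set.Icc (0 : ℝ) 1) :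
    IntervalIntegrable (profileFlux β m) volume y 1 := by
  refine (intervalIntegrable_profileFlux hβ hβ1 hm).mono_set ?_
  rw [Set.uIcc_of_le hy.2, Set.uIcc_of_le zero_le_one]
  exact Set.Icc_subset_Icc_left hy.1

lemma continuousOn_integral_profileFlux {β : ℝ} (hβ : 0 < β) (hβ1 : β < 1) {m : ℝ → ℝ}
    (hm : Continuous m) : ContinuousOn (fun y => ∫ s in y..1, profileFlux β m s) (Set.Icc 0 1) := by
  have h := intervalIntegral.continuousOn_primitive_interval_left (a := 0) (b := 1) (μ := volume)
    (f := profileFlux β m)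
    ((intervalIntegrable_iff' (by simp)).1 (intervalIntegrable_profileFlux hβ hβ1 hm))
  rwa [Set.uIcc_of_le zero_le_one] at h

/-! ### The Volterra equation, solved by contraction in an exponentially weighted norm. -/

/-- The function on the line attached to a continuous function on `[0,1]`, multiplied by the
exponential weight `exp (lam * (1 - y))`. -/
noncomputable def weightedExtension (lam : ℝ) (h : C(Set.Icc (0 : ℝ) 1, ℝ)) (y : ℝ) : ℝ :=
  Real.exp (lam * (1 - y)) * Set.IccExtend zero_le_one h y

lemma continuous_weightedExtension (lam : ℝ) (h : C(Set.Icc (0 : ℝ) 1, ℝ)) :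
    Continuous (weightedExtension lam h) := by
  unfold weightedExtension
  have := h.continuous.Icc_extend' (h := zero_le_one (α := ℝ))
  fun_prop

/-- The Volterra operator `φ ↦ 1 - ∫_y^1 J(g ∘ φ)`, conjugated with the exponential weight. -/
noncomputable def volterraMap {β : ℝ} (hβ : 0 < β) (hβ1 : β < 1) (lam : ℝ) {g : ℝ → ℝ}
    (hg : Continuous g) (h : C(Set.Icc (0 : ℝ) 1, ℝ)) : C(Set.Icc (0 : ℝ) 1, ℝ) where
  toFun y := Real.exp (-(lam * (1 - (y : ℝ)))) *
    (1 - ∫ s in (y : ℝ)..1, profileFlux β (g ∘ weightedExtension lam h) s)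
  continuous_toFun := by
    have h1 := continuousOn_iff_continuous_domRestrict.1 (continuousOn_integral_profileFlux hβ hβ1
      (hg.comp (continuous_weightedExtension lam h)))
    refine Continuous.mul (by fun_prop) (continuous_const.sub ?_)
    exact h1

/-- The flux costs a factor `1/β` and keeps the decreasing bound `exp (lam * (1 - s))`; integrating
this exponential gains `1/lam`, and the conjugating weight removes it. Two nonlinearities are
allowed so that one estimate gives both the contraction (`g₁ = g₂`) and the dependence on the
parameter (`h₁ = h₂`). -/
lemma dist_volterraMap_le {β : ℝ} (hβ : 0 < β) (hβ1 : β < 1) {lam : ℝ} (hl : 0 < lam)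
    {g₁ g₂ : ℝ → ℝ} (hg₁ : Continuous g₁) (hg₂ : Continuous g₂) (h₁ h₂ : C(Set.Icc (0 : ℝ) 1, ℝ))
    {K : ℝ} (hK0 : 0 ≤ K)
    (hK : ∀ σ ∈ Set.Icc (0 : ℝ) 1, |g₁ (weightedExtension lam h₁ σ) -
      g₂ (weightedExtension lam h₂ σ)| ≤ K * Real.exp (lam * (1 - σ))) :
    dist (volterraMap hβ hβ1 lam hg₁ h₁) (volterraMap hβ hβ1 lam hg₂ h₂) ≤ K / (β * lam) := by
  rw [ContinuousMap.dist_le (by positivity)]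
  intro y
  obtain ⟨y, hy⟩ := y
  set m₁ := g₁ ∘ weightedExtension lam h₁ with hm₁
  set m₂ := g₂ ∘ weightedExtension lam h₂ with hm₂
  have c₁ : Continuous m₁ := hg₁.comp (continuous_weightedExtension lam h₁)
  have c₂ : Continuous m₂ := hg₂.comp (continuous_weightedExtension lam h₂)
  have i₁ := intervalIntegrable_profileFlux_left hβ hβ1 c₁ hy
  have i₂ := intervalIntegrable_profileFlux_left hβ hβ1 c₂ hy
  have hcont : Continuous fun s : ℝ => K / β * Real.exp (lam * (1 - s)) := by fun_prop
  have hprim : ∫ s in y..1, K / β * Real.exp (lam * (1 - s))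
      = K / (β * lam) * (Real.exp (lam * (1 - y)) - 1) := by
    have hd : ∀ s ∈ Set.uIcc y 1, HasDerivAt (fun s => -(K / (β * lam)) * Real.exp (lam * (1 - s)))
        (K / β * Real.exp (lam * (1 - s))) s := by
      intro s _
      have := ((((hasDerivAt_id s).const_sub 1).const_mul lam).exp).const_mul (-(K / (β * lam)))
      refine this.congr_deriv ?_
      simp only [id]
      field_simp
    rw [intervalIntegral.integral_eq_sub_of_hasDerivAt hd (hcont.intervalIntegrable _ _)]
    simp; ring
  have hb : ‖∫ s in y..1, (profileFlux β m₁ s - profileFlux β m₂ s)‖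
      ≤ ∫ s in y..1, K / β * Real.exp (lam * (1 - s)) := by
    refine intervalIntegral.norm_integral_le_of_norm_le hy.2 ?_
      (hcont.intervalIntegrable (μ := volume) y 1)
    have : ∀ᵐ t : ℝ, t ≠ 1 := by simp [ae_iff, measure_singleton]
    filter_upwards [this] with s hs1 hs
    have hs1' : s < 1 := lt_of_le_of_ne hs.2 hs1
    have hs0 : 0 ≤ s := hy.1.trans hs.1.le
    rw [profileFlux_sub hβ c₁ c₂ (by linarith), Real.norm_eq_abs]
    refine (abs_profileFlux_le' hβ hβ1 (K := K * Real.exp (lam * (1 - s))) hs0 hs1' ?_).trans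
      (le_of_eq (by ring))
    intro σ hσ
    refine (hK σ ⟨hs0.trans hσ.1, hσ.2⟩).trans ?_
    have := hσ.1
    gcongr
  rw [hprim, intervalIntegral.integral_sub i₁ i₂] at hb
  rw [Real.norm_eq_abs] at hb
  change |Real.exp (-(lam * (1 - y))) * (1 - ∫ s in y..1, profileFlux β m₁ s)
    - Real.exp (-(lam * (1 - y))) * (1 - ∫ s in y..1, profileFlux β m₂ s)| ≤ _
  rw [← mul_sub, abs_mul, abs_of_pos (Real.exp_pos _), Real.exp_neg,
    inv_mul_le_iff₀ (Real.exp_pos _), sub_sub_sub_cancel_left, abs_sub_comm]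
  refine hb.trans ?_
  have : 0 ≤ K / (β * lam) := by positivity
  nlinarith

/-- Solutions of the Volterra equation exist and depend continuously on the parameter of a family
of nonlinearities that is uniformly Lipschitz. -/
theorem exists_continuousOn_volterra {β : ℝ} (hβ : 0 < β) (hβ1 : β < 1) (g : ℝ → ℝ → ℝ) {M L : ℝ}
    (hL : 0 ≤ L)
    (hlip : ∀ μ ∈ Set.Icc 0 M, ∀ x y, |g μ x - g μ y| ≤ L * |x - y|)
    (hpar : ∀ μ ∈ Set.Icc 0 M, ∀ ν ∈ Set.Icc 0 M, ∀ x, |g μ x - g ν x| ≤ |μ - ν|) :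
    ∃ φ : ℝ → ℝ → ℝ, (∀ μ ∈ Set.Icc 0 M, Continuous (φ μ) ∧ ∀ y ∈ Set.Icc (0 : ℝ) 1,
        φ μ y = 1 - ∫ s in y..1, profileFlux β (g μ ∘ φ μ) s) ∧
      ContinuousOn (fun μ => φ μ 0) (Set.Icc 0 M) := by
  -- Chosen so that `L / (β * lam) ≤ 1/2`; the summand `1` keeps `lam` positive when `L = 0`.
  set lam : ℝ := 2 * L / β + 1 with hlam
  have hl : 0 < lam := by positivity
  have hgc : ∀ μ ∈ Set.Icc 0 M, Continuous (g μ) := fun μ hμ =>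
    (LipschitzWith.of_dist_le_mul (K := ⟨L, hL⟩) (fun x y => hlip μ hμ x y)).continuous
  have hcontr : ∀ μ (hμ : μ ∈ Set.Icc 0 M),
      ContractingWith (1 / 2) (volterraMap hβ hβ1 lam (hgc μ hμ)) := by
    intro μ hμ
    refine ⟨by rw [← NNReal.coe_lt_coe]; norm_num, LipschitzWith.of_dist_le_mul fun h₁ h₂ => ?_⟩
    refine (dist_volterraMap_le hβ hβ1 hl (hgc μ hμ) (hgc μ hμ) h₁ h₂
      (K := L * dist h₁ h₂) (by positivity) ?_).trans ?_
    · intro σ hσ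
      refine (hlip μ hμ _ _).trans ?_
      rw [weightedExtension, weightedExtension, ← mul_sub, abs_mul, abs_of_pos (Real.exp_pos _),
        Set.IccExtend_of_mem _ _ hσ, Set.IccExtend_of_mem _ _ hσ, mul_assoc, mul_comm (dist h₁ h₂)]
      have := ContinuousMap.dist_apply_le_dist (f := h₁) (g := h₂) ⟨σ, hσ⟩
      rw [Real.dist_eq] at this
      gcongr
    · have h2 : L / (β * lam) ≤ 1 / 2 := by
        rw [div_le_div_iff₀ (by positivity) (by norm_num), hlam]
        field_simp
        linarith
      have h3 := mul_le_mul_of_nonneg_right h2 (dist_nonneg (x := h₁) (y := h₂))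
      rw [NNReal.coe_div]
      calc _ = L / (β * lam) * dist h₁ h₂ := by ring
        _ ≤ _ := by simpa using h3
  let h : ℝ → C(Set.Icc (0 : ℝ) 1, ℝ) := fun μ =>
    if hμ : μ ∈ Set.Icc 0 M then (hcontr μ hμ).fixedPoint else 0
  have hfix : ∀ μ (hμ : μ ∈ Set.Icc 0 M), volterraMap hβ hβ1 lam (hgc μ hμ) (h μ) = h μ := by
    intro μ hμ
    simp only [h, hμ, dif_pos]
    exact (hcontr μ hμ).fixedPoint_isFixedPt
  refine ⟨fun μ => weightedExtension lam (h μ), fun μ hμ => ⟨continuous_weightedExtension _ _, ?_⟩, ?_⟩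
  · intro y hy
    have h1 := congrArg (fun k : C(Set.Icc (0 : ℝ) 1, ℝ) => k ⟨y, hy⟩) (hfix μ hμ)
    change weightedExtension lam (h μ) y = _
    rw [weightedExtension, Set.IccExtend_of_mem _ _ hy]
    refine (congrArg (Real.exp (lam * (1 - y)) * ·) h1.symm).trans ?_
    change Real.exp (lam * (1 - y)) * (Real.exp (-(lam * (1 - y))) * _) = _
    rw [← mul_assoc, ← Real.exp_add]
    simp
  -- Fixed points of two `1/2`-contractions are at most twice as far apart as the maps are.
  · have hdist : ∀ μ ∈ Set.Icc 0 M, ∀ ν ∈ Set.Icc 0 M,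
        dist (h μ) (h ν) ≤ (2 / (β * lam)) * dist μ ν := by
      intro μ hμ ν hν
      refine ((hcontr μ hμ).dist_fixedPoint_fixedPoint_of_dist_le' _ (hfix μ hμ) (hfix ν hν)
        (C := |μ - ν| / (β * lam)) fun z => ?_).trans (le_of_eq ?_)
      · refine dist_volterraMap_le hβ hβ1 hl _ _ z z (abs_nonneg _) fun σ hσ => ?_
        refine (hpar μ hμ ν hν _).trans (le_mul_of_one_le_right (abs_nonneg _) ?_)
        exact Real.one_le_exp (mul_nonneg hl.le (by linarith [hσ.2]))
      · rw [Real.dist_eq]; norm_num; ring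
    have hc : ContinuousOn h (Set.Icc 0 M) :=
      (LipschitzOnWith.of_dist_le_mul (K := ⟨2 / (β * lam), by positivity⟩) hdist).continuousOn
    have h0 : (0 : ℝ) ∈ Set.Icc (0 : ℝ) 1 := by simp
    have : (fun μ => weightedExtension lam (h μ) 0) = fun μ => Real.exp lam * h μ ⟨0, h0⟩ := by
      ext μ
      rw [weightedExtension, Set.IccExtend_of_mem _ _ h0]; simp
    rw [this]
    exact continuousOn_const.mul
      ((continuous_eval_const _).comp_continuousOn hc)

/-! ### Shooting in the parameter `μ`, with a nonlinearity truncated to be nonnegative and globally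
Lipschitz. -/

/-- Truncation of a real number to `[0,1]`. -/
noncomputable def unitClamp (z : ℝ) : ℝ := max 0 (min z 1)

lemma unitClamp_mem (z : ℝ) : unitClamp z ∈ Set.Icc (0 : ℝ) 1 :=
  ⟨le_max_left _ _, max_le zero_le_one (min_le_right _ _)⟩

lemma unitClamp_of_mem {z : ℝ} (hz : z ∈ Set.Icc (0 : ℝ) 1) : unitClamp z = z := by
  rw [unitClamp, min_eq_left hz.2, max_eq_right hz.1]

lemma unitClamp_mono : Monotone unitClamp := fun x y h => by
  unfold unitClamp; gcongr

lemma abs_unitClamp_sub_le (x y : ℝ) : |unitClamp x - unitClamp y| ≤ |x - y| := by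
  unfold unitClamp
  refine (abs_max_sub_max_le_max _ _ _ _).trans ?_
  simp only [sub_self, abs_zero]
  refine max_le (abs_nonneg _) ((abs_min_sub_min_le_max _ _ _ _).trans ?_)
  simp

lemma abs_rpow_sub_rpow_le {p : ℝ} (hp : 1 ≤ p) {x y : ℝ} (hx : x ∈ Set.Icc (0 : ℝ) 1)
    (hy : y ∈ Set.Icc (0 : ℝ) 1) : |x ^ p - y ^ p| ≤ p * |x - y| := by
  refine (convex_Icc (0 : ℝ) 1).norm_image_sub_le_of_norm_hasDerivWithin_le
    (f := fun z : ℝ => z ^ p) (f' := fun z => p * z ^ (p - 1))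
    (fun z _ => (Real.hasDerivAt_rpow_const (Or.inr hp)).hasDerivWithinAt) ?_ hy hx
  intro z hz
  have : 0 ≤ z ^ (p - 1) := Real.rpow_nonneg hz.1 _
  rw [Real.norm_eq_abs, abs_of_nonneg (by positivity)]
  exact mul_le_of_le_one_right (by linarith) (Real.rpow_le_one hz.1 hz.2 (by linarith))

/-- The truncated nonlinearity `c z + μ z ^ p`. -/
noncomputable def clampedNL (c p μ z : ℝ) : ℝ := c * unitClamp z + μ * unitClamp z ^ p

lemma clampedNL_nonneg {c p μ : ℝ} (hc : 0 ≤ c) (hμ : 0 ≤ μ) (z : ℝ) : 0 ≤ clampedNL c p μ z :=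
  add_nonneg (mul_nonneg hc (unitClamp_mem z).1)
    (mul_nonneg hμ (Real.rpow_nonneg (unitClamp_mem z).1 _))

lemma clampedNL_le {c p μ : ℝ} (hc : 0 ≤ c) (hp : 0 ≤ p) (hμ : 0 ≤ μ) (z : ℝ) :
    clampedNL c p μ z ≤ c + μ :=
  add_le_add (mul_le_of_le_one_right hc (unitClamp_mem z).2)
    (mul_le_of_le_one_right hμ (Real.rpow_le_one (unitClamp_mem z).1 (unitClamp_mem z).2 hp))

lemma continuous_clampedNL {c p : ℝ} (hp : 0 ≤ p) (μ : ℝ) : Continuous (clampedNL c p μ) := by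
  unfold clampedNL unitClamp
  exact (by fun_prop : Continuous fun z : ℝ => c * max 0 (min z 1)).add
    (continuous_const.mul (Continuous.rpow_const (by fun_prop) fun _ => Or.inr hp))

/-- Some solution of the Volterra equation vanishes at the origin. -/
theorem exists_volterra_zero {β p : ℝ} (hβ : 0 < β) (hβ1 : β < 1) (hp : 1 ≤ p) :
    ∃ (μ : ℝ) (φ : ℝ → ℝ), 0 < μ ∧ Continuous φ ∧ φ 0 = 0 ∧ ∀ y ∈ Set.Icc (0 : ℝ) 1,
      φ y = 1 - ∫ s in y..1, profileFlux β (clampedNL (β * (1 - β)) p μ ∘ φ) s := by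
  set c : ℝ := β * (1 - β) with hc
  have hc0 : 0 ≤ c := mul_nonneg hβ.le (by linarith)
  have hc1 : c ≤ 1 := by nlinarith
  -- Possible since `M^(1-β) → ∞`. The right side is the lower bound found below for the integral of
  -- the flux over `[0, 1 - δ]`.
  obtain ⟨M, hM1, hM⟩ : ∃ M : ℝ, 1 ≤ M ∧
      1 ≤ (β / 4) ^ β * M ^ (1 - β) * ((1 / 2) ^ p / (4 * β)) * (1 / 2) := by
    have ht := (tendsto_rpow_atTop (y := 1 - β) (by linarith)).eventually_ge_atTop
      (2 * (4 * β) / ((β / 4) ^ β * (1 / 2) ^ p))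
    obtain ⟨M, h1, h2⟩ := (ht.and (eventually_ge_atTop 1)).exists
    refine ⟨M, h2, ?_⟩
    have q1 : 0 < (β / 4) ^ β := by positivity
    have q2 : (0 : ℝ) < (1 / 2) ^ p := by positivity
    rw [div_le_iff₀ (by positivity)] at h1
    rw [← sub_nonneg]
    have : (β / 4) ^ β * M ^ (1 - β) * ((1 / 2) ^ p / (4 * β)) * (1 / 2) - 1
      = (M ^ (1 - β) * ((β / 4) ^ β * (1 / 2) ^ p) - 2 * (4 * β)) / (2 * (4 * β)) := by
      field_simp
    rw [this]
    exact div_nonneg (by linarith) (by positivity)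
  have hM0 : 0 ≤ M := by linarith
  obtain ⟨φ, hφ, hφc⟩ := exists_continuousOn_volterra hβ hβ1 (clampedNL c p) (M := M)
    (L := c + M * p) (by positivity)
    (by
      intro μ hμ x y
      have e1 := abs_unitClamp_sub_le x y
      have e2 := (abs_rpow_sub_rpow_le hp (unitClamp_mem x) (unitClamp_mem y)).trans
        (mul_le_mul_of_nonneg_left e1 (by linarith))
      calc |clampedNL c p μ x - clampedNL c p μ y|
          = |c * (unitClamp x - unitClamp y) + μ * (unitClamp x ^ p - unitClamp y ^ p)| := by
            unfold clampedNL; ring_nf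
        _ ≤ c * |unitClamp x - unitClamp y| + μ * |unitClamp x ^ p - unitClamp y ^ p| := by
            refine (abs_add_le _ _).trans ?_
            rw [abs_mul c, abs_mul μ, abs_of_nonneg hc0, abs_of_nonneg hμ.1]
        _ ≤ c * |x - y| + M * (p * |x - y|) := by
            have := hμ.1
            have := hμ.2
            gcongr
        _ = _ := by ring)
    (by
      intro μ _ ν _ x
      have : clampedNL c p μ x - clampedNL c p ν x = (μ - ν) * unitClamp x ^ p := by
        unfold clampedNL; ring
      have h0 := Real.rpow_nonneg (unitClamp_mem x).1 p
      rw [this, abs_mul, abs_of_nonneg h0]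
      exact mul_le_of_le_one_right (abs_nonneg _)
        (Real.rpow_le_one (unitClamp_mem x).1 (unitClamp_mem x).2 (by linarith)))
  have z01 : (0 : ℝ) ∈ Set.Icc (0 : ℝ) 1 := by simp
  have cont : ∀ μ ∈ Set.Icc 0 M, Continuous (clampedNL c p μ ∘ φ μ) := fun μ hμ =>
    (continuous_clampedNL (by linarith) μ).comp (hφ μ hμ).1
  have bound : ∀ μ ∈ Set.Icc 0 M, ∀ s ∈ Set.Ico (0 : ℝ) 1,
      |profileFlux β (clampedNL c p μ ∘ φ μ) s| ≤ (c + μ) / β := by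
    intro μ hμ s hs
    refine abs_profileFlux_le' hβ hβ1 hs.1 hs.2 fun σ _ => ?_
    rw [Function.comp_apply, abs_of_nonneg (clampedNL_nonneg hc0 hμ.1 _)]
    exact clampedNL_le hc0 (by linarith) hμ.1 _
  -- The flux bound is a slope bound: `φ μ` cannot fall below the line of slope `(c + μ) / β`
  -- through `(1, 1)`. At `μ = 0`, `y = 0` this line has height `β > 0`.
  have intbound : ∀ μ ∈ Set.Icc 0 M, ∀ y ∈ Set.Icc (0 : ℝ) 1,
      1 - (c + μ) / β * (1 - y) ≤ φ μ y := by
    intro μ hμ y hy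
    rw [(hφ μ hμ).2 y hy]
    have : ‖∫ s in y..1, profileFlux β (clampedNL c p μ ∘ φ μ) s‖ ≤ (c + μ) / β * |1 - y| := by
      refine intervalIntegral.norm_integral_le_of_norm_le_const_ae ?_
      have : ∀ᵐ t : ℝ, t ≠ 1 := by simp [ae_iff, measure_singleton]
      filter_upwards [this] with s hs1 hs
      rw [Set.uIoc_of_le hy.2] at hs
      exact bound μ hμ s ⟨hy.1.trans hs.1.le, lt_of_le_of_ne hs.2 hs1⟩
    rw [abs_of_nonneg (by linarith [hy.2])] at this
    have := (le_abs_self _).trans this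
    linarith
  have mem0 : (0 : ℝ) ∈ Set.Icc 0 M := ⟨le_rfl, hM0⟩
  have memM : M ∈ Set.Icc 0 M := ⟨hM0, le_rfl⟩
  have pos0 : 0 < φ 0 0 := by
    have h := intbound 0 mem0 0 z01
    have : (c + 0) / β = 1 - β := by rw [hc]; field_simp; ring
    rw [this] at h
    linarith
  have negM : φ M 0 ≤ 0 := by
    -- By the slope bound, `φ M ≥ 1/2` within distance `δ` of `1`. There the nonlinearity is at
    -- least `M * (1/2)^p`, and this feeds the flux at every point of `[0, 1 - δ]`.
    set δ : ℝ := β / (2 * (c + M)) with hδ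
    have hcM : 0 < c + M := by linarith
    have hδ0 : 0 < δ := by positivity
    have hδ2 : δ ≤ 1 / 2 := by
      rw [hδ, div_le_div_iff₀ (by positivity) (by norm_num)]; nlinarith
    -- Uses `c ≤ 1 ≤ M`.
    have hδ4 : β / (4 * M) ≤ δ := by
      exact div_le_div_of_nonneg_left hβ.le (by positivity) (by linarith)
    have large : ∀ σ ∈ Set.Icc (1 - δ) 1, M * (1 / 2) ^ p ≤ (clampedNL c p M ∘ φ M) σ := by
      intro σ hσ
      have h := intbound M memM σ ⟨by linarith [hσ.1], hσ.2⟩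
      have h2 : (c + M) / β * (1 - σ) ≤ (c + M) / β * δ := by
        have := hσ.1
        gcongr
        linarith
      have h3 : (c + M) / β * δ = 1 / 2 := by rw [hδ]; field_simp
      have h4 : (1 : ℝ) / 2 ≤ unitClamp (φ M σ) := by
        have := unitClamp_mono (show (1 : ℝ) / 2 ≤ φ M σ by linarith)
        rwa [unitClamp_of_mem ⟨by norm_num, by norm_num⟩] at this
      have h5 : 0 ≤ c * unitClamp (φ M σ) := mul_nonneg hc0 (unitClamp_mem _).1
      have h6 : M * (1 / 2) ^ p ≤ M * unitClamp (φ M σ) ^ p := by gcongr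
      simp only [Function.comp_apply, clampedNL]
      linarith
    set J := profileFlux β (clampedNL c p M ∘ φ M) with hJ
    have hi := intervalIntegrable_profileFlux hβ hβ1 (cont M memM)
    have hi1 : IntervalIntegrable J volume 0 (1 - δ) := by
      refine hi.mono_set ?_
      rw [Set.uIcc_of_le (by linarith), Set.uIcc_of_le zero_le_one]
      exact Set.Icc_subset_Icc_right (by linarith)
    have hi2 := intervalIntegrable_profileFlux_left hβ hβ1 (cont M memM) (y := 1 - δ)
      ⟨by linarith, by linarith⟩
    have n2 : 0 ≤ ∫ s in (1 - δ)..1, J s := by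
      refine intervalIntegral.integral_nonneg_of_ae_restrict (by linarith) ?_
      have : ∀ᵐ t : ℝ, t ≠ 1 := by simp [ae_iff, measure_singleton]
      filter_upwards [ae_restrict_of_ae this, ae_restrict_mem measurableSet_Icc] with s hs1 hs
      exact profileFlux_nonneg (by linarith [hs.1]) (lt_of_le_of_ne hs.2 hs1)
        fun σ _ => clampedNL_nonneg hc0 hM0 _
    have n1 : (1 - δ) * (δ ^ β * (M * (1 / 2) ^ p) / (4 * β)) ≤ ∫ s in (0 : ℝ)..(1 - δ), J s := by
      have : ∫ s in (0 : ℝ)..(1 - δ), δ ^ β * (M * (1 / 2) ^ p) / (4 * β)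
          ≤ ∫ s in (0 : ℝ)..(1 - δ), J s := by
        refine intervalIntegral.integral_mono_on (by linarith) (by simp) hi1 fun s hs => ?_
        have := le_profileFlux hβ hβ1 (cont M memM) hs.1 hs.2 (by linarith)
          (fun σ _ => clampedNL_nonneg hc0 hM0 _) large (by positivity)
        rwa [sub_sub_cancel] at this
      rwa [intervalIntegral.integral_const, sub_zero, smul_eq_mul] at this
    have key : 1 ≤ (1 - δ) * (δ ^ β * (M * (1 / 2) ^ p) / (4 * β)) := by
      have k1 : (β / 4) ^ β * M ^ (1 - β) ≤ δ ^ β * M := by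
        have : (β / (4 * M)) ^ β ≤ δ ^ β := by gcongr
        refine le_trans (le_of_eq ?_) (mul_le_mul_of_nonneg_right this hM0)
        have hMp : 0 < M := by linarith
        rw [show β / (4 * M) = β / 4 / M by field_simp, Real.div_rpow (by positivity) hM0,
          Real.rpow_sub hMp, Real.rpow_one]
        field_simp
      calc (1 : ℝ) ≤ (β / 4) ^ β * M ^ (1 - β) * ((1 / 2) ^ p / (4 * β)) * (1 / 2) := hM
        _ ≤ δ ^ β * M * ((1 / 2) ^ p / (4 * β)) * (1 - δ) := by
            gcongr
            linarith
        _ = _ := by ring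
    rw [(hφ M memM).2 0 z01, ← intervalIntegral.integral_add_adjacent_intervals hi1 hi2]
    linarith
  obtain ⟨μ, hμ, h0⟩ := intermediate_value_Icc' hM0 hφc ⟨negM, pos0.le⟩
  -- The value `μ = 0` is excluded because `φ 0 0 > 0`; positivity of `μ` is what allows the
  -- rescaling by `κ = μ^(1/(p-1))`.
  refine ⟨μ, φ μ, lt_of_le_of_ne hμ.1 ?_, (hφ μ hμ).1, h0, (hφ μ hμ).2⟩
  rintro rfl
  exact pos0.ne' h0

/-! ### Removal of the truncation, rescaling and odd reflection. -/

lemma profileWeight_neg (β σ : ℝ) : profileWeight β (-σ) = profileWeight β σ := by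
  unfold profileWeight
  rw [mul_comm, sub_neg_eq_add, ← sub_eq_add_neg]

/-- The flux of an odd function is even. -/
lemma profileFlux_neg {β : ℝ} (hβ : 0 < β) {m : ℝ → ℝ} (hm : Continuous m)
    (hodd : ∀ y, m (-y) = -m y) {s : ℝ} (h1 : -1 < s) (h2 : s < 1) :
    profileFlux β m (-s) = profileFlux β m s := by
  have hz : ∫ σ in (-s)..s, profileWeight β σ * m σ = 0 := by
    have h := intervalIntegral.integral_comp_neg (a := -s) (b := s)
      (fun σ => profileWeight β σ * m σ)
    simp only [profileWeight_neg, hodd, neg_neg, mul_neg, intervalIntegral.integral_neg] at h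
    linarith
  have i1 := intervalIntegrable_profileWeight_mul hβ hm (a := -s) (b := s) (by linarith) h1
  have i2 := intervalIntegrable_profileWeight_mul hβ hm (a := s) (b := 1) h1 (by norm_num)
  rw [profileFlux, profileFlux, ← intervalIntegral.integral_add_adjacent_intervals i1 i2, hz,
    zero_add, sub_neg_eq_add, ← sub_eq_add_neg, mul_comm ((1 + s) ^ (-β))]

lemma continuous_abs_rpow_mul {q : ℝ} (hq : 0 ≤ q) : Continuous fun z : ℝ => |z| ^ q * z :=
  (Continuous.rpow_const (by fun_prop) fun _ => Or.inr hq).mul continuous_id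

/-- There is an odd profile which is bounded together with its derivative. -/
theorem exists_bounded_odd_profile {β p : ℝ} (hβ : 0 < β) (hβ1 : β < 1) (hp : 1 < p) :
    ∃ (f f' : ℝ → ℝ) (K : ℝ), Continuous f ∧ (∀ y, f (-y) = -f y) ∧ 0 < f' 0 ∧
      ∀ y ∈ Set.Ioo (-1 : ℝ) 1, HasDerivAt f (f' y) y ∧
        HasDerivAt f' ((2 * β * y * f' y - (β * (1 - β) * f y + |f y| ^ (p - 1) * f y))
          / (1 - y ^ 2)) y ∧ |f y| ≤ K ∧ |f' y| ≤ K := by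
  obtain ⟨μ, φ, hμ, hφ, hφ0, heq⟩ := exists_volterra_zero hβ hβ1 hp.le
  set c : ℝ := β * (1 - β) with hc
  have hc0 : 0 ≤ c := mul_nonneg hβ.le (by linarith)
  -- Since `κ^(p-1) = μ`, multiplication by `κ` turns `cφ + μφ^p` into `cf + f^p` with `f = κφ`.
  set κ : ℝ := μ ^ (1 / (p - 1)) with hκ
  have hκ0 : 0 < κ := Real.rpow_pos_of_pos hμ _
  have hκp : κ ^ (p - 1) = μ := by
    rw [hκ, ← Real.rpow_mul hμ.le, one_div_mul_cancel (by linarith), Real.rpow_one]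
  set J := profileFlux β (clampedNL c p μ ∘ φ) with hJ
  have hgc : Continuous (clampedNL c p μ ∘ φ) := (continuous_clampedNL (by linarith) μ).comp hφ
  have hg0 : ∀ σ, 0 ≤ (clampedNL c p μ ∘ φ) σ := fun σ => clampedNL_nonneg hc0 hμ.le _
  have z01 : (0 : ℝ) ∈ Set.Icc (0 : ℝ) 1 := by simp
  have hint := intervalIntegrable_profileFlux hβ hβ1 hgc
  have hint0 : ∀ y ∈ Set.Icc (0 : ℝ) 1, IntervalIntegrable J volume 0 y := fun y hy => by
    refine hint.mono_set ?_
    rw [Set.uIcc_of_le hy.1, Set.uIcc_of_le zero_le_one]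
    exact Set.Icc_subset_Icc_right hy.2
  have hφint : ∀ y ∈ Set.Icc (0 : ℝ) 1, φ y = ∫ s in (0 : ℝ)..y, J s := by
    intro y hy
    have h1 := intervalIntegral.integral_add_adjacent_intervals (hint0 y hy)
      (intervalIntegrable_profileFlux_left hβ hβ1 hgc hy)
    have h2 := heq 0 z01
    rw [heq y hy]
    linarith
  have hne : ∀ᵐ t : ℝ, t ≠ 1 := by simp [ae_iff, measure_singleton]
  -- The flux is nonnegative, so `φ` increases from `0` to `1` and the truncation is inactive along
  -- it.
  have hφmem : ∀ y ∈ Set.Icc (0 : ℝ) 1, φ y ∈ Set.Icc (0 : ℝ) 1 := by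
    intro y hy
    constructor
    · rw [hφint y hy]
      refine intervalIntegral.integral_nonneg_of_ae_restrict hy.1 ?_
      filter_upwards [ae_restrict_of_ae hne, ae_restrict_mem measurableSet_Icc] with s hs1 hs
      exact profileFlux_nonneg hs.1 (lt_of_le_of_ne (hs.2.trans hy.2) hs1) fun σ _ => hg0 σ
    · rw [heq y hy, sub_le_self_iff]
      refine intervalIntegral.integral_nonneg_of_ae_restrict hy.2 ?_
      filter_upwards [ae_restrict_of_ae hne, ae_restrict_mem measurableSet_Icc] with s hs1 hs
      exact profileFlux_nonneg (hy.1.trans hs.1) (lt_of_le_of_ne hs.2 hs1) fun σ _ => hg0 σ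
  -- One formula for the odd reflection: one of the two terms is always `φ 0 = 0`.
  set F : ℝ → ℝ := fun y => κ * (φ (max y 0) - φ (max (-y) 0)) with hF
  have hFc : Continuous F := by fun_prop
  have hFodd : ∀ y, F (-y) = -F y := fun y => by simp only [hF, neg_neg]; ring
  have hFpos : ∀ y, 0 ≤ y → F y = κ * φ y := fun y hy => by
    simp only [hF]
    rw [max_eq_left hy, max_eq_right (by linarith), hφ0, sub_zero]
  set m : ℝ → ℝ := fun y => c * F y + |F y| ^ (p - 1) * F y with hm
  have hmc : Continuous m :=
    (continuous_const.mul hFc).add ((continuous_abs_rpow_mul (by linarith)).comp hFc)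
  have hmodd : ∀ y, m (-y) = -m y := fun y => by simp only [hm, hFodd, abs_neg]; ring
  have hmpos : ∀ y ∈ Set.Icc (0 : ℝ) 1, m y = κ * (clampedNL c p μ ∘ φ) y := by
    intro y hy
    have h0 := hφmem y hy
    have e : φ y ^ p = φ y ^ (p - 1) * φ y := by
      rcases h0.1.eq_or_lt with h | h
      · rw [← h]; simp [Real.zero_rpow (by linarith : p ≠ 0)]
      · rw [Real.rpow_sub_one h.ne']; field_simp
    simp only [hm, Function.comp_apply, clampedNL, unitClamp_of_mem h0, hFpos y hy.1]
    rw [abs_of_nonneg (mul_nonneg hκ0.le h0.1), Real.mul_rpow hκ0.le h0.1, hκp, e]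
    ring
  have hJm : ∀ s ∈ Set.Ico (0 : ℝ) 1, profileFlux β m s = κ * J s := by
    intro s hs
    have h : ∫ σ in s..1, profileWeight β σ * m σ
        = ∫ σ in s..1, κ * (profileWeight β σ * (clampedNL c p μ ∘ φ) σ) := by
      refine intervalIntegral.integral_congr fun σ hσ => ?_
      rw [Set.uIcc_of_le hs.2.le] at hσ
      simp only [hmpos σ ⟨hs.1.trans hσ.1, hσ.2⟩]
      ring
    rw [hJ, profileFlux, profileFlux, h, intervalIntegral.integral_const_mul]
    ring
  set f' := profileFlux β m with hf'
  have hFint : ∀ y ∈ Set.Ioo (-1 : ℝ) 1, F y = ∫ s in (0 : ℝ)..y, f' s := by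
    have hp : ∀ y ∈ Set.Ico (0 : ℝ) 1, F y = ∫ s in (0 : ℝ)..y, f' s := by
      intro y hy
      rw [hFpos y hy.1, hφint y ⟨hy.1, hy.2.le⟩, ← intervalIntegral.integral_const_mul]
      refine intervalIntegral.integral_congr fun s hs => ?_
      rw [Set.uIcc_of_le hy.1] at hs
      exact (hJm s ⟨hs.1, hs.2.trans_lt hy.2⟩).symm
    intro y hy
    rcases le_total 0 y with h | h
    · exact hp y ⟨h, hy.2⟩
    · have h1 := hp (-y) ⟨by linarith, by linarith [hy.1]⟩
      have h2 := intervalIntegral.integral_comp_neg (a := 0) (b := y) f'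
      rw [neg_zero] at h2
      have h3 : ∫ s in (0 : ℝ)..y, f' (-s) = ∫ s in (0 : ℝ)..y, f' s := by
        refine intervalIntegral.integral_congr fun s hs => ?_
        rw [Set.uIcc_of_ge h] at hs
        exact profileFlux_neg hβ hmc hmodd (by linarith [hs.1, hy.1]) (by linarith [hs.2])
      have h4 := intervalIntegral.integral_symm (μ := volume) (f := f') (-y) 0
      rw [hFodd] at h1
      linarith
  have hf'c : ContinuousOn f' (Set.Ioo (-1) 1) := fun y hy =>
    (continuousAt_profileFlux hβ hmc hy.1 hy.2).continuousWithinAt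
  obtain ⟨B, hB⟩ := (isCompact_Icc (a := (0 : ℝ)) (b := 1)).exists_bound_of_continuousOn
    hmc.continuousOn
  refine ⟨F, f', max κ (B / β), hFc, hFodd, ?_, fun y hy => ⟨?_, ?_, ?_, ?_⟩⟩
  · rw [hJm 0 ⟨le_rfl, one_pos⟩]
    refine mul_pos hκ0 (lt_of_le_of_ne (profileFlux_nonneg le_rfl one_pos fun σ _ => hg0 σ) ?_)
    -- If the flux vanished at `0`, the nonnegative weighted integrand would have zero integral over
    -- `[0,1]`, hence over every `[s,1]`. The flux would vanish identically and `φ 1 = φ 0 = 0`,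
    -- against `φ 1 = 1`.
    intro h0
    have hI0 : ∫ σ in (0 : ℝ)..1, profileWeight β σ * (clampedNL c p μ ∘ φ) σ = 0 := by
      have := h0
      simp only [hJ, profileFlux, sub_zero, add_zero, Real.one_rpow, one_mul] at this
      exact this.symm
    have hJ0 : ∀ s ∈ Set.Icc (0 : ℝ) 1, J s = 0 := by
      intro s hs
      have i1 := intervalIntegrable_profileWeight_mul hβ hgc (a := 0) (b := s) (by norm_num)
        (by linarith [hs.1])
      have i2 := intervalIntegrable_profileWeight_mul hβ hgc (a := s) (b := 1)
        (by linarith [hs.1]) (by norm_num)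
      have n1 : 0 ≤ ∫ σ in (0 : ℝ)..s, profileWeight β σ * (clampedNL c p μ ∘ φ) σ :=
        intervalIntegral.integral_nonneg hs.1 fun σ hσ => mul_nonneg
          (profileWeight_nonneg (by linarith [hσ.1]) (hσ.2.trans hs.2)) (hg0 σ)
      have n2 : 0 ≤ ∫ σ in s..1, profileWeight β σ * (clampedNL c p μ ∘ φ) σ :=
        intervalIntegral.integral_nonneg hs.2 fun σ hσ => mul_nonneg
          (profileWeight_nonneg (by linarith [hσ.1, hs.1]) hσ.2) (hg0 σ)
      have h := intervalIntegral.integral_add_adjacent_intervals i1 i2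
      rw [hJ, profileFlux, show ∫ σ in s..1, profileWeight β σ * (clampedNL c p μ ∘ φ) σ = 0 by
        linarith, mul_zero]
    have h1 : φ 1 = 1 := by
      have := heq 1 (by simp)
      simpa using this
    have h2 := hφint 1 (by simp)
    rw [intervalIntegral.integral_congr (g := fun _ => (0 : ℝ)) (fun s hs => hJ0 s (by
      rwa [Set.uIcc_of_le zero_le_one] at hs)), intervalIntegral.integral_zero] at h2
    linarith
  · have hd : HasDerivAt (fun y => ∫ s in (0 : ℝ)..y, f' s) (f' y) y := by
      refine intervalIntegral.integral_hasDerivAt_right ?_ ?_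
        (continuousAt_profileFlux hβ hmc hy.1 hy.2)
      · refine (hf'c.mono ?_).intervalIntegrable
        exact (Set.ordConnected_Ioo (a := (-1 : ℝ)) (b := 1)).uIcc_subset (by simp) hy
      · exact hf'c.stronglyMeasurableAtFilter isOpen_Ioo y hy
    refine hd.congr_of_eventuallyEq ?_
    filter_upwards [isOpen_Ioo.mem_nhds hy] with z hz using hFint z hz
  · exact hasDerivAt_profileFlux hβ hmc hy.1 hy.2
  · refine le_max_of_le_left ?_
    have hpos : ∀ z ∈ Set.Ico (0 : ℝ) 1, |F z| ≤ κ := by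
      intro z hz
      have h := hφmem z ⟨hz.1, hz.2.le⟩
      rw [hFpos z hz.1, abs_of_nonneg (mul_nonneg hκ0.le h.1)]
      exact mul_le_of_le_one_right hκ0.le h.2
    rcases le_total 0 y with h | h
    · exact hpos y ⟨h, hy.2⟩
    · have := hpos (-y) ⟨by linarith, by linarith [hy.1]⟩
      rwa [hFodd, abs_neg] at this
  · refine le_max_of_le_right ?_
    have hpos : ∀ z ∈ Set.Ico (0 : ℝ) 1, |f' z| ≤ B / β := fun z hz =>
      abs_profileFlux_le' hβ hβ1 hz.1 hz.2 fun σ hσ => hB σ ⟨hz.1.trans hσ.1, hσ.2⟩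
    rcases le_total 0 y with h | h
    · exact hpos y ⟨h, hy.2⟩
    · have := hpos (-y) ⟨by linarith, by linarith [hy.1]⟩
      rwa [hf', profileFlux_neg hβ hmc hmodd hy.1 hy.2] at this

/-! ### Archimedes' theorem and spherical means. -/

lemma volume_disc {ρ : ℝ} (hρ : 0 ≤ ρ) :
    volume {y : Fin 2 → ℝ | y 0 ^ 2 + y 1 ^ 2 < ρ} = ENNReal.ofReal (Real.pi * ρ) := by
  have hm : MeasurableSet {y : Fin 2 → ℝ | y 0 ^ 2 + y 1 ^ 2 < ρ} :=
    measurableSet_lt (by fun_prop) (by fun_prop)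
  rw [← (PiLp.volume_preserving_ofLp (Fin 2)).measure_preimage hm.nullMeasurableSet]
  have : (WithLp.ofLp ⁻¹' {y : Fin 2 → ℝ | y 0 ^ 2 + y 1 ^ 2 < ρ} : Set (EuclideanSpace ℝ (Fin 2)))
      = ball 0 (√ρ) := by
    ext y
    rw [mem_ball_zero_iff, EuclideanSpace.norm_eq, Real.sqrt_lt_sqrt_iff (by positivity)]
    simp [Fin.sum_univ_two]
  rw [this, EuclideanSpace.volume_ball_fin_two, ← ENNReal.ofReal_pow (Real.sqrt_nonneg _),
    Real.sq_sqrt hρ, ← ENNReal.ofReal_mul hρ, mul_comm]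

/-- The area of the horizontal slice of a solid circular sector of the unit ball. -/
noncomputable def sectorSlice (c z : ℝ) : ℝ :=
  if z ≤ c then Real.pi * ((1 - c ^ 2) / c ^ 2 * z ^ 2) else Real.pi * (1 - z ^ 2)

/-- The slice at height `z` is a disc bounded by the cone when `z ≤ c` and by the unit sphere when
`z > c`, since cone and sphere meet at height `c`. -/
lemma volume_sector_slice {c : ℝ} (hc : 0 ≤ c) (hc1 : c < 1) (z : ℝ) :
    volume {y : Fin 2 → ℝ | z ^ 2 + (y 0 ^ 2 + y 1 ^ 2) < 1 ∧
      c * √(z ^ 2 + (y 0 ^ 2 + y 1 ^ 2)) < z}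
    = (Set.Ioc (0 : ℝ) 1).indicator (fun z => ENNReal.ofReal (sectorSlice c z)) z := by
  have hlt : ∀ q : ℝ, 0 ≤ q → 0 < z → (c * √q < z ↔ c ^ 2 * q < z ^ 2) := by
    intro q hq hz
    rw [← sq_lt_sq₀ (by positivity) hz.le, mul_pow, Real.sq_sqrt hq]
  by_cases hz : z ∈ Set.Ioc (0 : ℝ) 1
  · rw [Set.indicator_of_mem hz, sectorSlice]
    split_ifs with h
    · have hc0 : 0 < c := hz.1.trans_le h
      rw [← volume_disc (by have : 0 ≤ 1 - c ^ 2 := by nlinarith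
                            positivity)]
      congr 1
      ext y
      have hq : 0 ≤ y 0 ^ 2 + y 1 ^ 2 := by positivity
      simp only [Set.mem_ofPred_eq]
      rw [hlt _ (by positivity) hz.1, div_mul_eq_mul_div, lt_div_iff₀ (by positivity)]
      have hz2 : z ^ 2 ≤ c ^ 2 := by have := hz.1; gcongr
      have hc2 : c ^ 2 < 1 := by nlinarith
      constructor
      · rintro ⟨-, h2⟩; nlinarith
      · intro h2
        refine ⟨?_, by nlinarith⟩
        by_contra hcon
        push Not at hcon
        have : c ^ 2 * (1 - z ^ 2) ≤ c ^ 2 * (y 0 ^ 2 + y 1 ^ 2) := by gcongr; linarith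
        nlinarith
    · push Not at h
      rw [← volume_disc (by nlinarith [hz.1, hz.2])]
      congr 1
      ext y
      simp only [Set.mem_ofPred_eq]
      rw [hlt _ (by positivity) hz.1]
      have hz2 : c ^ 2 < z ^ 2 := by gcongr
      constructor
      · rintro ⟨h1, -⟩; linarith
      · intro h1
        refine ⟨by linarith, ?_⟩
        have : c ^ 2 * (z ^ 2 + (y 0 ^ 2 + y 1 ^ 2)) ≤ c ^ 2 * 1 := by gcongr; linarith
        linarith
  · rw [Set.indicator_of_notMem hz]
    convert measure_empty (μ := (volume : Measure (Fin 2 → ℝ)))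
    ext y
    simp only [Set.mem_ofPred_eq, Set.mem_empty_iff_false, iff_false, not_and, not_lt]
    intro h1
    have hq : 0 ≤ y 0 ^ 2 + y 1 ^ 2 := by positivity
    rw [Set.mem_Ioc, not_and_or, not_lt, not_le] at hz
    rcases hz with hz | hz
    · exact hz.trans (by positivity)
    · nlinarith

lemma integral_sectorSlice {c : ℝ} (hc : 0 ≤ c) (hc1 : c < 1) :
    IntervalIntegrable (sectorSlice c) volume 0 1 ∧
      ∫ z in (0 : ℝ)..1, sectorSlice c z = 2 * Real.pi / 3 * (1 - c) := by
  have e1 : Set.EqOn (fun z => Real.pi * ((1 - c ^ 2) / c ^ 2 * z ^ 2)) (sectorSlice c)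
      (Set.uIoc 0 c) := by
    intro z hz
    rw [Set.uIoc_of_le hc] at hz
    simp [sectorSlice, hz.2]
  have e2 : Set.EqOn (fun z => Real.pi * (1 - z ^ 2)) (sectorSlice c) (Set.uIoc c 1) := by
    intro z hz
    rw [Set.uIoc_of_le hc1.le] at hz
    simp [sectorSlice, hz.1]
  have c1 : Continuous fun z : ℝ => Real.pi * ((1 - c ^ 2) / c ^ 2 * z ^ 2) := by fun_prop
  have c2 : Continuous fun z : ℝ => Real.pi * (1 - z ^ 2) := by fun_prop
  have i1 := (c1.intervalIntegrable (μ := volume) 0 c).congr e1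
  have i2 := (c2.intervalIntegrable (μ := volume) c 1).congr e2
  refine ⟨i1.trans i2, ?_⟩
  rw [← intervalIntegral.integral_add_adjacent_intervals i1 i2,
    ← intervalIntegral.integral_congr_ae (ae_of_all _ e1),
    ← intervalIntegral.integral_congr_ae (ae_of_all _ e2)]
  -- For `c = 0` the division by `c ^ 2` gives a default value, but the conical piece then lives on
  -- the empty range from `0` to `0`.
  rcases hc.eq_or_lt with h | h
  · rw [← h]
    simp [integral_pow]
    ring
  · simp [integral_pow]
    field_simp
    ring

lemma volume_sector_coord {c : ℝ} (hc : 0 ≤ c) (hc1 : c < 1) :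
    volume {x : E3 | ‖x‖ < 1 ∧ c * ‖x‖ < x 0} = ENNReal.ofReal (2 * Real.pi / 3 * (1 - c)) := by
  set S : Set (ℝ × (Fin 2 → ℝ)) := {w | w.1 ^ 2 + (w.2 0 ^ 2 + w.2 1 ^ 2) < 1 ∧
      c * √(w.1 ^ 2 + (w.2 0 ^ 2 + w.2 1 ^ 2)) < w.1} with hS
  have hSm : MeasurableSet S := by
    rw [hS, Set.ofPred_and]
    exact (measurableSet_lt (by fun_prop) (by fun_prop)).inter
      (measurableSet_lt (by fun_prop) (by fun_prop))
  have hmp := (volume_preserving_piFinSuccAbove (fun _ : Fin 3 => ℝ) 0).comp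
    (PiLp.volume_preserving_ofLp (Fin 3))
  have hpre : {x : E3 | ‖x‖ < 1 ∧ c * ‖x‖ < x 0} =
      (MeasurableEquiv.piFinSuccAbove (fun _ : Fin 3 => ℝ) 0 ∘ WithLp.ofLp) ⁻¹' S := by
    ext x
    have hn : ‖x‖ = √(x 0 ^ 2 + (x 1 ^ 2 + x 2 ^ 2)) := by
      rw [EuclideanSpace.norm_eq]
      simp [Fin.sum_univ_three, add_assoc]
    have h1 : (‖x‖ < 1 ↔ x 0 ^ 2 + (x 1 ^ 2 + x 2 ^ 2) < 1) := by
      rw [hn, Real.sqrt_lt' one_pos, one_pow]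
    rw [Set.mem_ofPred_eq, h1, hn]
    rfl
  rw [hpre, hmp.measure_preimage hSm.nullMeasurableSet]
  change (volume.prod volume) S = _
  rw [Measure.prod_apply hSm]
  have hsl : ∀ z : ℝ, volume (Prod.mk z ⁻¹' S)
      = (Set.Ioc (0 : ℝ) 1).indicator (fun z => ENNReal.ofReal (sectorSlice c z)) z :=
    fun z => volume_sector_slice hc hc1 z
  obtain ⟨hi, hI⟩ := integral_sectorSlice hc hc1
  simp_rw [hsl]
  rw [lintegral_indicator measurableSet_Ioc, ← hI, intervalIntegral.integral_of_le zero_le_one,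
    ofReal_integral_eq_lintegral_ofReal]
  · rwa [intervalIntegrable_iff_integrableOn_Ioc_of_le zero_le_one] at hi
  · filter_upwards [ae_restrict_mem measurableSet_Ioc] with z hz
    have hpi := Real.pi_pos
    have : 0 ≤ 1 - c ^ 2 := by nlinarith
    have : 0 ≤ 1 - z ^ 2 := by nlinarith [hz.1, hz.2]
    simp only [sectorSlice, Pi.zero_apply]
    split_ifs <;> positivity

/-- Rotation invariance: an orthonormal basis with first vector `e` carries the sector to the one
around the first coordinate axis. -/
lemma volume_sector {c : ℝ} (hc : 0 ≤ c) (hc1 : c < 1) {e : E3} (he : ‖e‖ = 1) :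
    volume {x : E3 | ‖x‖ < 1 ∧ c * ‖x‖ < inner ℝ e x}
      = ENNReal.ofReal (2 * Real.pi / 3 * (1 - c)) := by
  have ho : Orthonormal ℝ (({0} : Set (Fin 3)).domRestrict (fun _ => e)) := by
    constructor
    · intro i; exact he
    · intro i j hij
      exact absurd (Subsingleton.elim i j) hij
  obtain ⟨b, hb⟩ := ho.exists_orthonormalBasis_extension_of_card_eq (by simp)
  have hb0 : b 0 = e := hb 0 rfl
  have hm : MeasurableSet {x : E3 | ‖x‖ < 1 ∧ c * ‖x‖ < x 0} := by
    rw [Set.ofPred_and]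
    exact (measurableSet_lt (by fun_prop) (by fun_prop)).inter
      (measurableSet_lt (by fun_prop) (by fun_prop))
  rw [← volume_sector_coord hc hc1, ← b.measurePreserving_repr.measure_preimage hm.nullMeasurableSet]
  congr 1
  ext x
  simp [OrthonormalBasis.repr_apply_apply, hb0]

-- The surface measure `toSphere` of a set is three times the volume of the cone over it, and the
-- cone over a cap is a solid sector. For `c ≥ 1` the cap is empty and `ENNReal.ofReal` truncates
-- the right side to zero.
open scoped Pointwise in
lemma toSphere_cap {c : ℝ} (hc : 0 ≤ c) {e : E3} (he : ‖e‖ = 1) :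
    (volume : Measure E3).toSphere {θ | c < inner ℝ e (θ : E3)}
      = ENNReal.ofReal (2 * Real.pi * (1 - c)) := by
  have hm : MeasurableSet {θ : sphere (0 : E3) 1 | c < inner ℝ e (θ : E3)} :=
    measurableSet_lt (by fun_prop) (by fun_prop)
  rcases lt_or_ge c 1 with hc1 | hc1
  · rw [Measure.toSphere_apply' _ hm]
    have : Set.Ioo (0 : ℝ) 1 • (Subtype.val '' {θ : sphere (0 : E3) 1 | c < inner ℝ e (θ : E3)})
        = {x : E3 | ‖x‖ < 1 ∧ c * ‖x‖ < inner ℝ e x} := by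
      ext x
      simp only [Set.mem_smul, Set.mem_image, Set.mem_ofPred_eq]
      constructor
      · rintro ⟨r, hr, -, ⟨θ, hθ, rfl⟩, rfl⟩
        have hn : ‖(θ : E3)‖ = 1 := mem_sphere_zero_iff_norm.1 θ.2
        rw [norm_smul, hn, Real.norm_eq_abs, abs_of_pos hr.1, mul_one, inner_smul_right, mul_comm]
        exact ⟨hr.2, mul_lt_mul_of_pos_left hθ hr.1⟩
      · rintro ⟨h1, h2⟩
        have hx : x ≠ 0 := by rintro rfl; simp at h2
        have hx0 : 0 < ‖x‖ := norm_pos_iff.2 hx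
        refine ⟨‖x‖, ⟨hx0, h1⟩, ‖x‖⁻¹ • x, ⟨⟨‖x‖⁻¹ • x, ?_⟩, ?_, rfl⟩, ?_⟩
        · simp [norm_smul, hx0.ne']
        · simp only [inner_smul_right]
          rw [inv_mul_eq_div, lt_div_iff₀ hx0]
          exact h2
        · rw [smul_smul, mul_inv_cancel₀ hx0.ne', one_smul]
    rw [this, volume_sector hc hc1 he]
    simp only [finrank_euclideanSpace, Fintype.card_fin]
    rw [show ((3 : ℕ) : ℝ≥0∞) = ENNReal.ofReal 3 by simp, ← ENNReal.ofReal_mul (by norm_num)]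
    congr 1; ring
  · rw [ENNReal.ofReal_of_nonpos (by nlinarith [Real.pi_pos])]
    convert measure_empty (μ := (volume : Measure E3).toSphere)
    ext θ
    simp only [Set.mem_ofPred_eq, Set.mem_empty_iff_false, iff_false, not_lt]
    have := real_inner_le_norm e (θ : E3)
    rw [he, mem_sphere_zero_iff_norm.1 θ.2] at this
    linarith

lemma toSphere_univ_real : (volume : Measure E3).toSphere.real Set.univ = 4 * Real.pi := by
  rw [Measure.toSphere_real_apply_univ, measureReal_def, EuclideanSpace.volume_ball_fin_three]
  have := Real.pi_pos
  simp
  rw [ENNReal.toReal_ofReal (by positivity)]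
  ring

/-- Archimedes' theorem: the projection of surface measure of the unit sphere to a diameter is
uniform. -/
theorem toSphere_map_inner {e : E3} (he : ‖e‖ = 1) :
    (volume : Measure E3).toSphere.map (fun θ : sphere (0 : E3) 1 => inner ℝ e (θ : E3))
      = ENNReal.ofReal (2 * Real.pi) • volume.restrict (Set.Icc (-1 : ℝ) 1) := by
  have hpi := Real.pi_pos
  set σ := (volume : Measure E3).toSphere with hσ
  have hmeas : Measurable fun θ : sphere (0 : E3) 1 => (inner ℝ e (θ : E3) : ℝ) := by fun_prop
  have hcap : ∀ c, 0 ≤ c → ∀ e : E3, ‖e‖ = 1 → σ.real {θ | c < inner ℝ e (θ : E3)}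
      = max (2 * Real.pi * (1 - c)) 0 := fun c hc e he => by
    rw [measureReal_def, hσ, toSphere_cap hc he]; rfl
  -- Closed caps are squeezed between open ones. They are needed for `a < 0`, where `⟨e, θ⟩ ≤ a`
  -- describes a closed cap around `-e`.
  have hge : ∀ d, 0 < d → ∀ e : E3, ‖e‖ = 1 → σ.real {θ | d ≤ inner ℝ e (θ : E3)}
      = max (2 * Real.pi * (1 - d)) 0 := by
    intro d hd e he
    refine le_antisymm ?_ ?_
    · have hlim : Tendsto (fun c => max (2 * Real.pi * (1 - c)) 0) (𝓝[<] d)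
          (𝓝 (max (2 * Real.pi * (1 - d)) 0)) :=
        ((by fun_prop : Continuous fun c : ℝ => max (2 * Real.pi * (1 - c)) 0).tendsto d).mono_left
          nhdsWithin_le_nhds
      refine ge_of_tendsto hlim ?_
      filter_upwards [Ioo_mem_nhdsLT hd] with c hc
      rw [← hcap c hc.1.le e he]
      exact measureReal_mono fun θ hθ => lt_of_lt_of_le hc.2 hθ
    · rw [← hcap d hd.le e he]
      exact measureReal_mono fun θ hθ => show d ≤ inner ℝ e (θ : E3) from le_of_lt hθ
  have : IsFiniteMeasure (σ.map fun θ : sphere (0 : E3) 1 => (inner ℝ e (θ : E3) : ℝ)) := inferInstance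
  refine Measure.ext_of_Iic _ _ fun a => ?_
  rw [Measure.map_apply hmeas measurableSet_Iic, Measure.smul_apply,
    Measure.restrict_apply measurableSet_Iic, smul_eq_mul]
  have hl : σ.real ((fun θ : sphere (0 : E3) 1 => (inner ℝ e (θ : E3) : ℝ)) ⁻¹' Set.Iic a)
      = 2 * Real.pi * max (min a 1 + 1) 0 := by
    rcases le_or_gt 0 a with ha | ha
    · have h1 : (fun θ : sphere (0 : E3) 1 => (inner ℝ e (θ : E3) : ℝ)) ⁻¹' Set.Iic a
          = {θ : sphere (0 : E3) 1 | a < inner ℝ e (θ : E3)}ᶜ := by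
        ext θ; simp
      have hm : MeasurableSet {θ : sphere (0 : E3) 1 | a < inner ℝ e (θ : E3)} :=
        measurableSet_lt (by fun_prop) (by fun_prop)
      rw [h1, measureReal_compl hm, toSphere_univ_real, hcap a ha e he]
      rcases le_total a 1 with h | h
      · rw [min_eq_left h, max_eq_left (by nlinarith), max_eq_left (by linarith)]; ring
      · rw [min_eq_right h, max_eq_right (by nlinarith), max_eq_left (by linarith)]; ring
    · have h1 : (fun θ : sphere (0 : E3) 1 => (inner ℝ e (θ : E3) : ℝ)) ⁻¹' Set.Iic a
          = {θ : sphere (0 : E3) 1 | -a ≤ inner ℝ (-e) (θ : E3)} := by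
        ext θ; simp
      rw [h1, hge (-a) (by linarith) (-e) (by simpa using he), min_eq_left (by linarith),
        sub_neg_eq_add, mul_max_of_nonneg _ _ (by positivity), mul_zero, add_comm]
  have hr : volume (Set.Iic a ∩ Set.Icc (-1 : ℝ) 1) = ENNReal.ofReal (min a 1 + 1) := by
    have : Set.Iic a ∩ Set.Icc (-1 : ℝ) 1 = Set.Icc (-1) (min a 1) := by
      ext z; simp only [Set.mem_inter_iff, Set.mem_Iic, Set.mem_Icc, le_min_iff]; tauto
    rw [this, Real.volume_Icc, sub_neg_eq_add]
  rw [hr, ← ENNReal.ofReal_mul (by positivity), ← ENNReal.ofReal_toReal (measure_ne_top σ _),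
    ← measureReal_def, hl]
  rcases le_total (min a 1 + 1) 0 with h | h
  · rw [max_eq_right h, mul_zero, ENNReal.ofReal_zero, ENNReal.ofReal_of_nonpos (by nlinarith)]
  · rw [max_eq_left h]

lemma sphereMean_inner {e : E3} (he : ‖e‖ = 1) {k : ℝ → ℝ} (hk : Measurable k) :
    sphereMean (fun x => k (inner ℝ e x)) = 1 / 2 * ∫ ξ in (-1 : ℝ)..1, k ξ := by
  have hpi := Real.pi_pos
  have hmeas : Measurable fun θ : sphere (0 : E3) 1 => (inner ℝ e (θ : E3) : ℝ) := by fun_prop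
  rw [sphereMean, average_eq, toSphere_univ_real,
    ← integral_map (φ := fun θ : sphere (0 : E3) 1 => (inner ℝ e (θ : E3) : ℝ)) hmeas.aemeasurable
      hk.aestronglyMeasurable, toSphere_map_inner he, integral_smul_measure,
    integral_Icc_eq_integral_Ioc, ← intervalIntegral.integral_of_le (by norm_num),
    ENNReal.toReal_ofReal (by positivity), smul_smul, smul_eq_mul]
  congr 1
  field_simp
  norm_num

lemma sphereMean_congr {h₁ h₂ : E3 → ℝ} (h : ∀ θ : E3, ‖θ‖ = 1 → h₁ θ = h₂ θ) :
    sphereMean h₁ = sphereMean h₂ := by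
  unfold sphereMean
  congr 1
  ext θ
  exact h θ (mem_sphere_zero_iff_norm.1 θ.2)

/-! ### Reduction of the propagator to one dimension and d'Alembert's formula. -/

/-- The sine propagator on radial functions. -/
theorem sinProp_radial {H : ℝ → ℝ} (hH : Measurable H) {s : ℝ} {x : E3} (hs : |s| < ‖x‖)
    (hc : ContinuousOn H (Set.Icc (‖x‖ - |s|) (‖x‖ + |s|))) :
    sinProp s (fun y => H ‖y‖) x = 1 / (2 * ‖x‖) * ∫ ρ in (‖x‖ - s)..(‖x‖ + s), H ρ * ρ := by
  set r := ‖x‖ with hr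
  have hr0 : 0 < r := (abs_nonneg s).trans_lt hs
  have hsr := abs_lt.1 hs
  set e : E3 := r⁻¹ • x with he
  have hen : ‖e‖ = 1 := by rw [he, norm_smul, ← hr]; simp [abs_of_pos hr0, hr0.ne']
  -- This is `‖x + s • θ‖` as a function of `ξ = ⟨e, θ⟩`, which is uniform on `[-1,1]`. The
  -- substitution `ρ = f ξ` has `ρ dρ = s r dξ`; the sign of `s` is free, and `|s| < r` keeps `ρ`
  -- positive.
  set f : ℝ → ℝ := fun ξ => √(r ^ 2 + s ^ 2 + 2 * s * r * ξ) with hf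
  have hmean : sphereMean (fun θ => H ‖x + s • θ‖) = 1 / 2 * ∫ ξ in (-1 : ℝ)..1, H (f ξ) := by
    rw [← sphereMean_inner hen (k := fun ξ => H (f ξ)) (hH.comp (by fun_prop))]
    refine sphereMean_congr fun θ hθ => ?_
    congr 1
    rw [hf]
    simp only
    rw [eq_comm, Real.sqrt_eq_iff_eq_sq _ (norm_nonneg _), norm_add_sq_real, norm_smul, hθ, he,
      inner_smul_left, inner_smul_right, ← hr, Real.norm_eq_abs, mul_one, sq_abs]
    · simp only [conj_trivial]
      field_simp
      ring
    · have h2 := abs_real_inner_le_norm e θ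
      rw [hen, hθ, mul_one] at h2
      have h4 : |2 * s * r * inner ℝ e θ| ≤ 2 * |s| * r := by
        rw [abs_mul, abs_mul, abs_mul, abs_of_pos hr0, abs_two]
        exact mul_le_of_le_one_right (by positivity) h2
      have h5 := (abs_le.1 h4).1
      nlinarith [sq_nonneg (r - |s|), sq_abs s]
  have hQ : ∀ ξ ∈ Set.Icc (-1 : ℝ) 1, (r - |s|) ^ 2 ≤ r ^ 2 + s ^ 2 + 2 * s * r * ξ ∧
      r ^ 2 + s ^ 2 + 2 * s * r * ξ ≤ (r + |s|) ^ 2 := by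
    intro ξ hξ
    have h4 : |2 * s * r * ξ| ≤ 2 * |s| * r := by
      rw [abs_mul, abs_mul, abs_mul, abs_of_pos hr0, abs_two]
      exact mul_le_of_le_one_right (by positivity) (abs_le.2 hξ)
    have h5 := abs_le.1 h4
    constructor <;> nlinarith [sq_abs s]
  have hpos : ∀ ξ ∈ Set.Icc (-1 : ℝ) 1, 0 < r ^ 2 + s ^ 2 + 2 * s * r * ξ := fun ξ hξ =>
    lt_of_lt_of_le (by have : 0 < r - |s| := by linarith
                       positivity) (hQ ξ hξ).1
  have huIcc : Set.uIcc (-1 : ℝ) 1 = Set.Icc (-1) 1 := Set.uIcc_of_le (by norm_num)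
  have hsub : ∫ ξ in (-1 : ℝ)..1, ((fun ρ => H ρ * ρ) ∘ f) ξ * (s * r / f ξ)
      = ∫ ρ in f (-1)..f 1, H ρ * ρ := by
    refine intervalIntegral.integral_comp_mul_deriv'' (by fun_prop) ?_ ?_ ?_
    · intro ξ hξ
      rw [min_eq_left (by norm_num), max_eq_right (by norm_num)] at hξ
      have h0 := hpos ξ ⟨hξ.1.le, hξ.2.le⟩
      have hd : HasDerivAt (fun ξ => r ^ 2 + s ^ 2 + 2 * s * r * ξ) (2 * s * r) ξ := by
        simpa using ((hasDerivAt_id ξ).const_mul (2 * s * r)).const_add (r ^ 2 + s ^ 2)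
      refine (hd.sqrt h0.ne').hasDerivWithinAt.congr_deriv ?_
      have : f ξ ≠ 0 := (Real.sqrt_pos.2 h0).ne'
      simp only [hf]
      rw [mul_assoc 2 s r, mul_div_mul_left _ _ two_ne_zero]
    · refine ContinuousOn.div (by fun_prop) (by fun_prop) ?_
      intro ξ hξ
      rw [huIcc] at hξ
      exact (Real.sqrt_pos.2 (hpos ξ hξ)).ne'
    · refine (hc.mul continuousOn_id).mono ?_
      rintro _ ⟨ξ, hξ, rfl⟩
      rw [huIcc] at hξ
      constructor
      · exact Real.le_sqrt_of_sq_le (hQ ξ hξ).1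
      · exact Real.sqrt_le_iff.2 ⟨by positivity, (hQ ξ hξ).2⟩
  have f1 : f 1 = r + s := by
    rw [hf]
    simp only
    rw [show r ^ 2 + s ^ 2 + 2 * s * r * 1 = (r + s) ^ 2 by ring, Real.sqrt_sq (by linarith)]
  have f2 : f (-1) = r - s := by
    rw [hf]
    simp only
    rw [show r ^ 2 + s ^ 2 + 2 * s * r * -1 = (r - s) ^ 2 by ring, Real.sqrt_sq (by linarith)]
  rw [f1, f2] at hsub
  have hcong : ∫ ξ in (-1 : ℝ)..1, ((fun ρ => H ρ * ρ) ∘ f) ξ * (s * r / f ξ)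
      = (s * r) * ∫ ξ in (-1 : ℝ)..1, H (f ξ) := by
    rw [← intervalIntegral.integral_const_mul]
    refine intervalIntegral.integral_congr fun ξ hξ => ?_
    rw [huIcc] at hξ
    have : f ξ ≠ 0 := (Real.sqrt_pos.2 (hpos ξ hξ)).ne'
    simp only [Function.comp_apply]
    field_simp
  rw [sinProp, hmean, ← hsub, hcong]
  field_simp

/-- Fubini's theorem on a triangle. -/
theorem intervalIntegral_triangle_swap {K : ℝ → ℝ → ℝ} {t : ℝ} (ht : 0 ≤ t)
    (hK : ContinuousOn (Function.uncurry K) {z : ℝ × ℝ | 0 ≤ z.2 ∧ z.2 ≤ z.1 ∧ z.1 ≤ t}) :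
    ∫ τ in (0 : ℝ)..t, ∫ σ in (0 : ℝ)..τ, K τ σ = ∫ σ in (0 : ℝ)..t, ∫ τ in σ..t, K τ σ := by
  set T : Set (ℝ × ℝ) := {z : ℝ × ℝ | 0 ≤ z.2 ∧ z.2 ≤ z.1 ∧ z.1 ≤ t} with hT
  have hTcl : IsClosed T := by
    rw [hT, Set.ofPred_and, Set.ofPred_and]
    exact (isClosed_le (by fun_prop) (by fun_prop)).inter
      ((isClosed_le (by fun_prop) (by fun_prop)).inter (isClosed_le (by fun_prop) (by fun_prop)))
  have hTc : IsCompact T := by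
    refine (isCompact_Icc (a := ((0 : ℝ), (0 : ℝ))) (b := (t, t))).of_isClosed_subset hTcl ?_
    rintro ⟨τ, σ⟩ ⟨h1, h2, h3⟩
    simp only at h1 h2 h3
    exact ⟨⟨h1.trans h2, h1⟩, ⟨h3, h2.trans h3⟩⟩
  have hi : Integrable (Function.uncurry fun τ σ => T.indicator (Function.uncurry K) (τ, σ))
      (volume.prod volume) := by
    have := (hK.integrableOn_compact (μ := volume.prod volume) hTc).integrable_indicator
      hTcl.measurableSet
    exact this
  have hmem : ∀ τ σ, (τ, σ) ∈ T ↔ 0 ≤ σ ∧ σ ≤ τ ∧ τ ≤ t := fun τ σ => Iff.rfl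
  have hsw := integral_integral_swap hi
  have hL : ∀ τ, ∫ σ, T.indicator (Function.uncurry K) (τ, σ)
      = (Set.Icc 0 t).indicator (fun τ => ∫ σ in (0 : ℝ)..τ, K τ σ) τ := by
    intro τ
    by_cases hτ : τ ∈ Set.Icc 0 t
    · rw [Set.indicator_of_mem hτ, intervalIntegral.integral_of_le hτ.1,
        ← integral_Icc_eq_integral_Ioc, ← integral_indicator measurableSet_Icc]
      congr 1
      ext σ
      by_cases h : σ ∈ Set.Icc 0 τ
      · rw [Set.indicator_of_mem h, Set.indicator_of_mem ((hmem _ _).2 ⟨h.1, h.2, hτ.2⟩)]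
        rfl
      · rw [Set.indicator_of_notMem h, Set.indicator_of_notMem]
        exact fun h' => h ⟨h'.1, h'.2.1⟩
    · rw [Set.indicator_of_notMem hτ]
      refine integral_eq_zero_of_ae (ae_of_all _ fun σ => ?_)
      exact Set.indicator_of_notMem (fun h' => hτ ⟨h'.1.trans h'.2.1, h'.2.2⟩) _
  have hR : ∀ σ, ∫ τ, T.indicator (Function.uncurry K) (τ, σ)
      = (Set.Icc 0 t).indicator (fun σ => ∫ τ in σ..t, K τ σ) σ := by
    intro σ
    by_cases hσ : σ ∈ Set.Icc 0 t
    · rw [Set.indicator_of_mem hσ, intervalIntegral.integral_of_le hσ.2,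
        ← integral_Icc_eq_integral_Ioc, ← integral_indicator measurableSet_Icc]
      congr 1
      ext τ
      by_cases h : τ ∈ Set.Icc σ t
      · rw [Set.indicator_of_mem h, Set.indicator_of_mem ((hmem _ _).2 ⟨hσ.1, h.1, h.2⟩)]
        rfl
      · rw [Set.indicator_of_notMem h, Set.indicator_of_notMem]
        exact fun h' => h ⟨h'.2.1, h'.2.2⟩
    · rw [Set.indicator_of_notMem hσ]
      refine integral_eq_zero_of_ae (ae_of_all _ fun τ => ?_)
      exact Set.indicator_of_notMem (fun h' => hσ ⟨h'.1, h'.2.1.trans h'.2.2⟩) _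
  simp only [hL, hR] at hsw
  rwa [integral_indicator measurableSet_Icc, integral_indicator measurableSet_Icc,
    integral_Icc_eq_integral_Ioc, integral_Icc_eq_integral_Ioc,
    ← intervalIntegral.integral_of_le ht, ← intervalIntegral.integral_of_le ht] at hsw

/-- D'Alembert's formula in the exterior of the light cone `{ρ > |τ|}`: here `q = v_t + v_r` and
`h = v_tt - v_rr`, both given through derivatives along characteristics. -/
theorem dAlembert_exterior {v q h : ℝ → ℝ → ℝ}
    (hv : ∀ τ ρ, |τ| < ρ → HasDerivAt (fun s => v (τ + s) (ρ + s)) (q τ ρ) 0)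
    (hq : ∀ τ ρ, |τ| < ρ → HasDerivAt (fun s => q (τ + s) (ρ - s)) (h τ ρ) 0)
    (hqc : ContinuousOn (Function.uncurry q) {z : ℝ × ℝ | |z.1| < z.2})
    (hhc : ContinuousOn (Function.uncurry h) {z : ℝ × ℝ | |z.1| < z.2})
    (h0 : ∀ ρ, 0 < ρ → v 0 ρ = 0) {t r : ℝ} (ht : 0 ≤ t) (hr : t < r) :
    v t r = 1 / 2 * (∫ ρ in (r - t)..(r + t), q 0 ρ) +
      1 / 2 * ∫ τ in (0 : ℝ)..t, ∫ ρ in (r - (t - τ))..(r + (t - τ)), h τ ρ := by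
  -- Integration along the outgoing characteristic from `(0, r - t)` to `(t, r)`, which stays
  -- outside the cone because `r - t > 0`.
  have e1 : v t r = ∫ τ in (0 : ℝ)..t, q τ (r - t + τ) := by
    have hd : ∀ τ ∈ Set.uIcc 0 t, HasDerivAt (fun τ => v τ (r - t + τ)) (q τ (r - t + τ)) τ := by
      intro τ hτ
      rw [Set.uIcc_of_le ht] at hτ
      have h1 := hv τ (r - t + τ) (by rw [abs_of_nonneg hτ.1]; linarith)
      have h2 := HasDerivAt.comp_sub_const τ τ (f := fun s => v (τ + s) (r - t + τ + s))
        (by rwa [sub_self])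
      refine h2.congr_of_eventuallyEq (Eventually.of_forall fun z => ?_)
      simp only
      congr 1 <;> ring
    have hi : IntervalIntegrable (fun τ => q τ (r - t + τ)) volume 0 t := by
      refine ContinuousOn.intervalIntegrable ?_
      refine hqc.comp (f := fun τ => (τ, r - t + τ)) (by fun_prop) fun τ hτ => ?_
      rw [Set.uIcc_of_le ht] at hτ
      change |τ| < r - t + τ
      rw [abs_of_nonneg hτ.1]; linarith
    rw [intervalIntegral.integral_eq_sub_of_hasDerivAt hd hi, add_zero, h0 _ (by linarith)]
    simp
  -- Integration along the incoming characteristic through `(τ, r - t + τ)`, followed back to time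
  -- `0` at radius `r - t + 2τ`. The factors `1/2` in the formula come from this doubled variable.
  have e2 : ∀ τ ∈ Set.Icc 0 t, q τ (r - t + τ)
      = q 0 (2 * τ + (r - t)) + ∫ σ in (0 : ℝ)..τ, h σ (r - t + 2 * τ - σ) := by
    intro τ hτ
    have hcone : ∀ σ ∈ Set.uIcc 0 τ, |σ| < r - t + 2 * τ - σ := by
      intro σ hσ
      rw [Set.uIcc_of_le hτ.1] at hσ
      rw [abs_of_nonneg hσ.1]; linarith [hσ.2]
    have hd : ∀ σ ∈ Set.uIcc 0 τ, HasDerivAt (fun σ => q σ (r - t + 2 * τ - σ))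
        (h σ (r - t + 2 * τ - σ)) σ := by
      intro σ hσ
      have h1 := hq σ (r - t + 2 * τ - σ) (hcone σ hσ)
      have h2 := HasDerivAt.comp_sub_const σ σ (f := fun s => q (σ + s) (r - t + 2 * τ - σ - s))
        (by rwa [sub_self])
      refine h2.congr_of_eventuallyEq (Eventually.of_forall fun z => ?_)
      simp only
      congr 1 <;> ring
    have hi : IntervalIntegrable (fun σ => h σ (r - t + 2 * τ - σ)) volume 0 τ := by
      refine ContinuousOn.intervalIntegrable ?_
      exact hhc.comp (f := fun σ => (σ, r - t + 2 * τ - σ)) (by fun_prop) fun σ hσ => hcone σ hσ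
    rw [intervalIntegral.integral_eq_sub_of_hasDerivAt hd hi, sub_zero,
      show r - t + 2 * τ - τ = r - t + τ by ring, show 2 * τ + (r - t) = r - t + 2 * τ by ring]
    ring
  have hKc : ContinuousOn (Function.uncurry fun τ σ => h σ (r - t + 2 * τ - σ))
      {z : ℝ × ℝ | 0 ≤ z.2 ∧ z.2 ≤ z.1 ∧ z.1 ≤ t} := by
    refine hhc.comp (f := fun z : ℝ × ℝ => (z.2, r - t + 2 * z.1 - z.2)) (by fun_prop) ?_
    rintro ⟨τ, σ⟩ ⟨h1, h2, -⟩
    simp only at h1 h2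
    change |σ| < r - t + 2 * τ - σ
    rw [abs_of_nonneg h1]; linarith
  have hi1 : IntervalIntegrable (fun τ => q 0 (2 * τ + (r - t))) volume 0 t := by
    refine ContinuousOn.intervalIntegrable ?_
    refine hqc.comp (f := fun τ => ((0 : ℝ), 2 * τ + (r - t))) (by fun_prop) fun τ hτ => ?_
    rw [Set.uIcc_of_le ht] at hτ
    change |(0 : ℝ)| < 2 * τ + (r - t)
    rw [abs_zero]; linarith [hτ.1]
  have hi0 : IntervalIntegrable (fun τ => q τ (r - t + τ)) volume 0 t := by
    refine ContinuousOn.intervalIntegrable ?_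
    refine hqc.comp (f := fun τ => (τ, r - t + τ)) (by fun_prop) fun τ hτ => ?_
    rw [Set.uIcc_of_le ht] at hτ
    change |τ| < r - t + τ
    rw [abs_of_nonneg hτ.1]; linarith
  have hi2 : IntervalIntegrable (fun τ => ∫ σ in (0 : ℝ)..τ, h σ (r - t + 2 * τ - σ)) volume 0 t := by
    refine (hi0.sub hi1).congr fun τ hτ => ?_
    rw [Set.uIoc_of_le ht] at hτ
    simp only [e2 τ ⟨hτ.1.le, hτ.2⟩]
    ring
  rw [e1, intervalIntegral.integral_congr (g := fun τ => q 0 (2 * τ + (r - t)) +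
    ∫ σ in (0 : ℝ)..τ, h σ (r - t + 2 * τ - σ)) (fun τ hτ => e2 τ (by
      rwa [Set.uIcc_of_le ht] at hτ)), intervalIntegral.integral_add hi1 hi2,
    intervalIntegral_triangle_swap ht hKc,
    intervalIntegral.integral_comp_mul_add (fun ρ => q 0 ρ) two_ne_zero]
  congr 1
  · rw [smul_eq_mul, one_div]
    congr 2 <;> ring
  · rw [← intervalIntegral.integral_const_mul]
    refine intervalIntegral.integral_congr fun σ hσ => ?_
    have := intervalIntegral.integral_comp_mul_add (a := σ) (b := t) (fun ρ => h σ ρ) two_ne_zero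
      (r - t - σ)
    rw [show (fun τ => h σ (r - t + 2 * τ - σ)) = fun τ => h σ (2 * τ + (r - t - σ)) by
      ext τ; congr 1; ring, this, smul_eq_mul, one_div]
    congr 2 <;> ring

/-! ### Differential calculus of radial and self-similar functions. -/

lemma hasFDerivAt_norm_euclidean {x : E3} (hx : x ≠ 0) :
    HasFDerivAt (fun y : E3 => ‖y‖) (‖x‖⁻¹ • innerSL ℝ x) x := by
  have hx0 : 0 < ‖x‖ := norm_pos_iff.2 hx
  have h := ((hasStrictFDerivAt_norm_sq x).hasFDerivAt).sqrt (by positivity)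
  have h2 : (fun y : E3 => √(‖y‖ ^ 2)) = fun y => ‖y‖ := by
    ext y; exact Real.sqrt_sq (norm_nonneg y)
  rw [h2] at h
  refine h.congr_fderiv ?_
  ext v
  rw [Real.sqrt_sq hx0.le]
  simp
  field_simp

lemma HasDerivAt.hasFDerivAt_comp_norm {G : ℝ → ℝ} {G' : ℝ} {x : E3} (hx : x ≠ 0)
    (hG : HasDerivAt G G' ‖x‖) :
    HasFDerivAt (fun y : E3 => G ‖y‖) ((G' / ‖x‖) • innerSL ℝ x) x := by
  have h := hG.comp_hasFDerivAt x (hasFDerivAt_norm_euclidean hx)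
  rwa [smul_smul, ← div_eq_mul_inv] at h

lemma norm_gradient_comp_norm {G : ℝ → ℝ} {G' : ℝ} {x : E3} (hx : x ≠ 0)
    (hG : HasDerivAt G G' ‖x‖) : ‖∇ (fun y : E3 => G ‖y‖) x‖ = |G'| := by
  have hx0 : 0 < ‖x‖ := norm_pos_iff.2 hx
  rw [gradient, (hG.hasFDerivAt_comp_norm hx).fderiv, LinearIsometryEquiv.norm_map, norm_smul,
    innerSL_apply_norm, norm_div, norm_norm, Real.norm_eq_abs]
  field_simp

/-- The Laplacian of a radial function. -/
theorem laplacian_comp_norm {G G₁ : ℝ → ℝ} {G₂ : ℝ} {x : E3} (hx : x ≠ 0)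
    (hG : ∀ᶠ ρ in 𝓝 ‖x‖, HasDerivAt G (G₁ ρ) ρ) (hG₁ : HasDerivAt G₁ G₂ ‖x‖) :
    Δ (fun y : E3 => G ‖y‖) x = G₂ + 2 / ‖x‖ * G₁ ‖x‖ := by
  have hx0 : 0 < ‖x‖ := norm_pos_iff.2 hx
  set b := EuclideanSpace.basisFun (Fin 3) ℝ with hb
  rw [InnerProductSpace.laplacian_eq_iteratedFDeriv_orthonormalBasis _ b]
  have hfd : fderiv ℝ (fun y : E3 => G ‖y‖) =ᶠ[𝓝 x] fun y => (G₁ ‖y‖ / ‖y‖) • innerSL ℝ y := by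
    have h1 := (continuous_norm (E := E3)).continuousAt (x := x) |>.eventually hG
    filter_upwards [h1, isOpen_ne.mem_nhds hx] with y hy hy0
    exact (hy.hasFDerivAt_comp_norm hy0).fderiv
  have hq : HasDerivAt (fun ρ => G₁ ρ / ρ) ((G₂ * ‖x‖ - G₁ ‖x‖ * 1) / ‖x‖ ^ 2) ‖x‖ :=
    hG₁.div (hasDerivAt_id _) hx0.ne'
  have hd := (hq.hasFDerivAt_comp_norm hx).smul (innerSL ℝ (E := E3)).hasFDerivAt
  have hval : ∀ i, iteratedFDeriv ℝ 2 (fun y : E3 => G ‖y‖) x ![b i, b i]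
      = G₁ ‖x‖ / ‖x‖ + (G₂ * ‖x‖ - G₁ ‖x‖) / ‖x‖ ^ 2 / ‖x‖ * (inner ℝ (b i) x) ^ 2 := by
    intro i
    rw [iteratedFDeriv_two_apply, hfd.fderiv_eq]
    have hd' := hd.fderiv
    have e : fderiv ℝ (fun y : E3 => (G₁ ‖y‖ / ‖y‖) • innerSL ℝ y) x
      = _ := hd'
    rw [e]
    have hbi : inner ℝ (b i) (b i) = (1 : ℝ) := by
      rw [real_inner_self_eq_norm_sq, b.orthonormal.1 i, one_pow]
    simp only [Matrix.cons_val_zero, Matrix.cons_val_one, add_apply,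
      smul_apply, ContinuousLinearMap.smulRight_apply, innerSL_apply_apply,
      smul_eq_mul, mul_one]
    change _ * inner ℝ (b i) (b i) + _ * inner ℝ x (b i) * inner ℝ x (b i) = _
    rw [hbi, real_inner_comm x (b i)]
    ring
  simp only [hval]
  rw [Finset.sum_add_distrib, ← Finset.mul_sum, b.sum_sq_inner_right]
  simp
  field_simp
  ring

/-- The self-similar function `|x|^(-β) f(t/|x|)`, as a function of time and radius. -/
noncomputable def selfSimilar (β : ℝ) (f : ℝ → ℝ) (t ρ : ℝ) : ℝ := ρ ^ (-β) * f (t / ρ)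

lemma hasDerivAt_rpow_neg {β ρ : ℝ} (hρ : 0 < ρ) :
    HasDerivAt (fun ρ : ℝ => ρ ^ (-β)) (-β * (ρ ^ (-β) / ρ)) ρ := by
  rw [← Real.rpow_sub_one hρ.ne']
  exact Real.hasDerivAt_rpow_const (Or.inl hρ.ne')

lemma hasDerivAt_const_div {t ρ : ℝ} (hρ : 0 < ρ) :
    HasDerivAt (fun ρ : ℝ => t / ρ) (-(t / ρ) / ρ) ρ := by
  have := (hasDerivAt_inv hρ.ne').const_mul t
  simp only [← div_eq_mul_inv] at this
  refine this.congr_deriv ?_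
  field_simp

lemma div_mem_Ioo {t ρ : ℝ} (h : |t| < ρ) : t / ρ ∈ Set.Ioo (-1 : ℝ) 1 := by
  have hρ : 0 < ρ := (abs_nonneg t).trans_lt h
  rw [Set.mem_Ioo, ← abs_lt, abs_div, abs_of_pos hρ, div_lt_one hρ]
  exact h

lemma hasDerivAt_selfSimilar_radius {β : ℝ} {f f' : ℝ → ℝ}
    (hf : ∀ y ∈ Set.Ioo (-1 : ℝ) 1, HasDerivAt f (f' y) y) {t ρ : ℝ} (h : |t| < ρ) :
    HasDerivAt (fun ρ => selfSimilar β f t ρ)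
      (selfSimilar β (fun y => -β * f y - y * f' y) t ρ / ρ) ρ := by
  have hρ : 0 < ρ := (abs_nonneg t).trans_lt h
  have h1 := (hasDerivAt_rpow_neg (β := β) hρ).mul
    ((hf _ (div_mem_Ioo h)).comp ρ (hasDerivAt_const_div (t := t) hρ))
  refine h1.congr_deriv ?_
  simp only [selfSimilar, Function.comp_apply]
  field_simp
  ring

lemma hasDerivAt_selfSimilar_time {β : ℝ} {f f' : ℝ → ℝ}
    (hf : ∀ y ∈ Set.Ioo (-1 : ℝ) 1, HasDerivAt f (f' y) y) {t ρ : ℝ} (h : |t| < ρ) :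
    HasDerivAt (fun t => selfSimilar β f t ρ) (selfSimilar β f' t ρ / ρ) t := by
  have hρ : 0 < ρ := (abs_nonneg t).trans_lt h
  have h1 := ((hf _ (div_mem_Ioo h)).comp t ((hasDerivAt_id t).div_const ρ)).const_mul (ρ ^ (-β))
  refine h1.congr_deriv ?_
  simp only [selfSimilar]
  field_simp

/-- Along an outgoing characteristic `y = t/ρ` has derivative `(1-y)/ρ`, and `ρ * ρ^(-β)`
contributes the factor `1-β`. This supplies `q` in d'Alembert's formula for `ρ u`. -/
lemma hasDerivAt_mul_selfSimilar_outgoing {β : ℝ} {f f' : ℝ → ℝ}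
    (hf : ∀ y ∈ Set.Ioo (-1 : ℝ) 1, HasDerivAt f (f' y) y) {τ ρ : ℝ} (h : |τ| < ρ) :
    HasDerivAt (fun s => (ρ + s) * selfSimilar β f (τ + s) (ρ + s))
      (selfSimilar β (fun y => (1 - β) * f y + (1 - y) * f' y) τ ρ) 0 := by
  have hρ : 0 < ρ := (abs_nonneg τ).trans_lt h
  have d1 : HasDerivAt (fun s => ρ + s) 1 0 := by simpa using (hasDerivAt_id (0 : ℝ)).const_add ρ
  have d2 : HasDerivAt (fun s => τ + s) 1 0 := by simpa using (hasDerivAt_id (0 : ℝ)).const_add τ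
  have d3 : HasDerivAt (fun s => (τ + s) / (ρ + s)) ((1 - τ / ρ) / ρ) 0 := by
    refine (d2.div d1 (by simpa using hρ.ne')).congr_deriv ?_
    simp only [add_zero]
    field_simp
  have d4 : HasDerivAt (fun s => (ρ + s) ^ (-β)) (-β * (ρ ^ (-β) / ρ)) 0 := by
    have h0 : HasDerivAt (fun ρ : ℝ => ρ ^ (-β)) (-β * (ρ ^ (-β) / ρ)) (ρ + 0) := by
      simpa using hasDerivAt_rpow_neg (β := β) hρ
    exact (h0.comp 0 d1).congr_deriv (by ring)
  have d5 : HasDerivAt (fun s => f ((τ + s) / (ρ + s))) (f' (τ / ρ) * ((1 - τ / ρ) / ρ)) 0 := by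
    have h0 : HasDerivAt f (f' (τ / ρ)) ((τ + 0) / (ρ + 0)) := by
      simpa using hf _ (div_mem_Ioo h)
    exact h0.comp 0 d3
  refine (d1.mul (d4.mul d5)).congr_deriv ?_
  simp only [selfSimilar, add_zero, Pi.mul_apply]
  field_simp
  ring

lemma hasDerivAt_selfSimilar_incoming {β : ℝ} {f f' : ℝ → ℝ}
    (hf : ∀ y ∈ Set.Ioo (-1 : ℝ) 1, HasDerivAt f (f' y) y) {τ ρ : ℝ} (h : |τ| < ρ) :
    HasDerivAt (fun s => selfSimilar β f (τ + s) (ρ - s))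
      (selfSimilar β (fun y => β * f y + (1 + y) * f' y) τ ρ / ρ) 0 := by
  have hρ : 0 < ρ := (abs_nonneg τ).trans_lt h
  have d1 : HasDerivAt (fun s => ρ - s) (-1) 0 := by simpa using (hasDerivAt_id (0 : ℝ)).const_sub ρ
  have d2 : HasDerivAt (fun s => τ + s) 1 0 := by simpa using (hasDerivAt_id (0 : ℝ)).const_add τ
  have d3 : HasDerivAt (fun s => (τ + s) / (ρ - s)) ((1 + τ / ρ) / ρ) 0 := by
    refine (d2.div d1 (by simpa using hρ.ne')).congr_deriv ?_
    simp only [add_zero, sub_zero]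
    field_simp
    ring
  have d4 : HasDerivAt (fun s => (ρ - s) ^ (-β)) (β * (ρ ^ (-β) / ρ)) 0 := by
    have h0 : HasDerivAt (fun ρ : ℝ => ρ ^ (-β)) (-β * (ρ ^ (-β) / ρ)) (ρ - 0) := by
      simpa using hasDerivAt_rpow_neg (β := β) hρ
    exact (h0.comp 0 d1).congr_deriv (by ring)
  have d5 : HasDerivAt (fun s => f ((τ + s) / (ρ - s))) (f' (τ / ρ) * ((1 + τ / ρ) / ρ)) 0 := by
    have h0 : HasDerivAt f (f' (τ / ρ)) ((τ + 0) / (ρ - 0)) := by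
      simpa using hf _ (div_mem_Ioo h)
    exact h0.comp 0 d3
  refine (d4.mul d5).congr_deriv ?_
  simp only [selfSimilar, add_zero, sub_zero]
  field_simp

lemma continuousOn_selfSimilar {β : ℝ} {f : ℝ → ℝ} (hf : ContinuousOn f (Set.Ioo (-1) 1)) :
    ContinuousOn (Function.uncurry (selfSimilar β f)) {z : ℝ × ℝ | |z.1| < z.2} := by
  have hpos : ∀ z ∈ {z : ℝ × ℝ | |z.1| < z.2}, z.2 ≠ 0 := fun z hz =>
    ((abs_nonneg _).trans_lt hz).ne'
  refine ContinuousOn.mul ?_ ?_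
  · exact ContinuousOn.rpow_const (by fun_prop) fun z hz => Or.inl (hpos z hz)
  · refine hf.comp (f := fun z : ℝ × ℝ => z.1 / z.2) (ContinuousOn.div (by fun_prop) (by fun_prop) hpos) ?_
    intro z hz
    exact div_mem_Ioo hz

lemma contDiffOn_selfSimilar_norm {β : ℝ} {f : ℝ → ℝ} (hf : ContDiffOn ℝ 2 f (Set.Ioo (-1) 1)) :
    ContDiffOn ℝ 2 (Function.uncurry fun t (x : E3) => selfSimilar β f t ‖x‖) (extRegion 0) := by
  have hmem : ∀ z ∈ extRegion 0, |z.1| < ‖z.2‖ := fun z hz => by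
    have : |z.1| + 0 < ‖z.2‖ := hz
    simpa using this
  have hne : ∀ z ∈ extRegion 0, z.2 ≠ 0 := fun z hz =>
    norm_pos_iff.1 ((abs_nonneg _).trans_lt (hmem z hz))
  have hn : ContDiffOn ℝ 2 (fun z : ℝ × E3 => ‖z.2‖) (extRegion 0) :=
    ContDiffOn.norm ℝ (by fun_prop) hne
  refine ContDiffOn.mul ?_ ?_
  · exact hn.rpow_const_of_ne fun z hz => norm_ne_zero_iff.2 (hne z hz)
  · refine hf.comp (f := fun z : ℝ × E3 => z.1 / ‖z.2‖) ?_ ?_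
    · exact ContDiffOn.div (by fun_prop) hn fun z hz => norm_ne_zero_iff.2 (hne z hz)
    · exact fun z hz => div_mem_Ioo (hmem z hz)

/-! ### Integrability of powers of the norm away from the origin. -/

lemma measurableSet_norm_gt (R : ℝ) : MeasurableSet {x : E3 | R < ‖x‖} :=
  measurableSet_lt (by fun_prop) (by fun_prop)

lemma integrableOn_norm_rpow {k R : ℝ} (hk : k < -3) (hR : 0 < R) :
    IntegrableOn (fun x : E3 => ‖x‖ ^ k) {x | R < ‖x‖} := by
  rw [← integrable_indicator_iff (measurableSet_norm_gt R)]
  have h : ({x : E3 | R < ‖x‖}.indicator fun x => ‖x‖ ^ k)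
      = fun x : E3 => (Set.Ioi R).indicator (fun ρ : ℝ => ρ ^ k) ‖x‖ := by
    ext x
    by_cases hx : R < ‖x‖
    · rw [Set.indicator_of_mem (show x ∈ {x : E3 | R < ‖x‖} from hx), Set.indicator_of_mem (show ‖x‖ ∈ Set.Ioi R from hx)]
    · rw [Set.indicator_of_notMem (show x ∉ {x : E3 | R < ‖x‖} from hx), Set.indicator_of_notMem (show ‖x‖ ∉ Set.Ioi R from hx)]
  rw [h, integrable_fun_norm_addHaar]
  have h2 : IntegrableOn ((Set.Ioi R).indicator fun ρ : ℝ => ρ ^ (k + 2)) (Set.Ioi 0) := by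
    refine Integrable.integrableOn ?_
    rw [integrable_indicator_iff measurableSet_Ioi]
    exact integrableOn_Ioi_rpow_of_lt (by linarith) hR
  refine h2.congr_fun (fun ρ hρ => ?_) measurableSet_Ioi
  by_cases h : ρ ∈ Set.Ioi R
  · rw [Set.indicator_of_mem h, Set.indicator_of_mem h]
    rw [Real.rpow_add hρ]
    simp [mul_comm]
  · rw [Set.indicator_of_notMem h, Set.indicator_of_notMem h]
    simp

lemma memLp_norm_rpow {k R q : ℝ} (hR : 0 < R) (hq : 0 < q) (hk : k * q < -3) (C : ℝ) :
    MemLp (fun x : E3 => C * ‖x‖ ^ k) (ENNReal.ofReal q) (volume.restrict {x | R < ‖x‖}) := by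
  rw [← integrable_norm_rpow_iff (Measurable.aestronglyMeasurable (by fun_prop))
    (by simpa using hq) ENNReal.ofReal_ne_top, ENNReal.toReal_ofReal hq.le]
  have h := (integrableOn_norm_rpow hk hR).const_mul (|C| ^ q)
  refine h.congr (ae_of_all _ fun x => ?_)
  simp only
  rw [norm_mul, Real.norm_eq_abs C, Real.norm_rpow_of_nonneg (norm_nonneg x), norm_norm,
    Real.mul_rpow (abs_nonneg _) (Real.rpow_nonneg (norm_nonneg x) _), Real.rpow_mul (norm_nonneg x)]

/-- Dominated convergence: the power is integrable on `|x| > R`, and each fixed `x` leaves the slice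
once `|t| ≥ |x|`. The general filter covers both time directions. -/
lemma tendsto_setLIntegral_extSlice {k R : ℝ} (hk : k < -3) (hR : 0 < R) (C : ℝ) {l : Filter ℝ}
    [l.IsCountablyGenerated] (hl : Tendsto (fun t : ℝ => |t|) l atTop) :
    Tendsto (fun t => ∫⁻ x in extSlice R t, ENNReal.ofReal (C * ‖x‖ ^ k)) l (𝓝 0) := by
  have hm : ∀ t, MeasurableSet (extSlice R t) := fun t => measurableSet_norm_gt (|t| + R)
  have hF : Measurable fun x : E3 => ENNReal.ofReal (C * ‖x‖ ^ k) := by fun_prop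
  have h0 : (0 : ℝ≥0∞) = ∫⁻ _ : E3, 0 := by simp
  simp_rw [← fun t => lintegral_indicator (μ := volume) (hm t)
    (fun x : E3 => ENNReal.ofReal (C * ‖x‖ ^ k))]
  rw [h0]
  refine tendsto_lintegral_filter_of_dominated_convergence
    ({x : E3 | R < ‖x‖}.indicator fun x => ENNReal.ofReal (C * ‖x‖ ^ k))
    (Eventually.of_forall fun t => hF.indicator (hm t)) (Eventually.of_forall fun t => ?_) ?_ ?_
  · refine ae_of_all _ fun x => Set.indicator_le_indicator_of_subset ?_ (fun _ => zero_le) x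
    intro y hy
    have h1 : |t| + R < ‖y‖ := hy
    have := abs_nonneg t
    change R < ‖y‖
    linarith
  · rw [lintegral_indicator (measurableSet_norm_gt R)]
    exact ((integrableOn_norm_rpow hk hR).const_mul C).lintegral_lt_top.ne
  · refine ae_of_all _ fun x => ?_
    refine tendsto_const_nhds.congr' ?_
    filter_upwards [hl.eventually_ge_atTop ‖x‖] with t ht
    rw [Set.indicator_of_notMem]
    intro hx
    have h1 : |t| + R < ‖x‖ := hx
    linarith

/-- D'Alembert's formula for all times, when `v` and `h` are odd in time. -/
theorem dAlembert_exterior_of_odd {v q h : ℝ → ℝ → ℝ}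
    (hv : ∀ τ ρ, |τ| < ρ → HasDerivAt (fun s => v (τ + s) (ρ + s)) (q τ ρ) 0)
    (hq : ∀ τ ρ, |τ| < ρ → HasDerivAt (fun s => q (τ + s) (ρ - s)) (h τ ρ) 0)
    (hqc : ContinuousOn (Function.uncurry q) {z : ℝ × ℝ | |z.1| < z.2})
    (hhc : ContinuousOn (Function.uncurry h) {z : ℝ × ℝ | |z.1| < z.2})
    (hvo : ∀ τ ρ, v (-τ) ρ = -v τ ρ) (hho : ∀ τ ρ, h (-τ) ρ = -h τ ρ)
    {t r : ℝ} (hr : |t| < r) :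
    v t r = 1 / 2 * (∫ ρ in (r - t)..(r + t), q 0 ρ) +
      1 / 2 * ∫ τ in (0 : ℝ)..t, ∫ ρ in (r - (t - τ))..(r + (t - τ)), h τ ρ := by
  have h0 : ∀ ρ, 0 < ρ → v 0 ρ = 0 := fun ρ _ => by
    have := hvo 0 ρ
    rw [neg_zero] at this
    linarith
  rcases le_total 0 t with ht | ht
  · exact dAlembert_exterior hv hq hqc hhc h0 ht (by rwa [abs_of_nonneg ht] at hr)
  · have h1 := dAlembert_exterior hv hq hqc hhc h0 (t := -t) (r := r) (by linarith)
      (by rwa [abs_of_nonpos ht] at hr)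
    have h2 : ∫ τ in (0 : ℝ)..(-t), ∫ ρ in (r - (-t - τ))..(r + (-t - τ)), h τ ρ
        = -∫ τ in (0 : ℝ)..t, ∫ ρ in (r - (t - τ))..(r + (t - τ)), h τ ρ := by
      have h3 := intervalIntegral.integral_comp_neg (a := t) (b := 0)
        (fun τ => ∫ ρ in (r - (-t - τ))..(r + (-t - τ)), h τ ρ)
      rw [neg_zero] at h3
      rw [← h3, ← intervalIntegral.integral_symm]
      refine intervalIntegral.integral_congr fun τ _ => ?_
      simp only [hho, intervalIntegral.integral_neg]
      rw [← intervalIntegral.integral_symm]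
      congr 1 <;> ring
    rw [hvo, h2, sub_neg_eq_add, ← sub_eq_add_neg, intervalIntegral.integral_symm] at h1
    linarith

/-! ### From a bounded odd profile to a non-radiative solution. -/

/-- An odd profile, bounded together with its derivative `f'`. -/
structure IsBoundedOddProfile (β p K : ℝ) (f f' : ℝ → ℝ) : Prop where
  continuous : Continuous f
  odd : ∀ y, f (-y) = -f y
  hasDerivAt : ∀ y ∈ Set.Ioo (-1 : ℝ) 1, HasDerivAt f (f' y) y
  hasDerivAt' : ∀ y ∈ Set.Ioo (-1 : ℝ) 1, HasDerivAt f'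
    ((2 * β * y * f' y - (β * (1 - β) * f y + |f y| ^ (p - 1) * f y)) / (1 - y ^ 2)) y
  bound : ∀ y ∈ Set.Ioo (-1 : ℝ) 1, |f y| ≤ K
  bound' : ∀ y ∈ Set.Ioo (-1 : ℝ) 1, |f' y| ≤ K

namespace IsBoundedOddProfile

lemma zero {β p K : ℝ} {f f' : ℝ → ℝ} (hf : IsBoundedOddProfile β p K f f') : f 0 = 0 := by
  have := hf.odd 0
  rw [neg_zero] at this
  linarith

lemma one_sub_sq_ne {y : ℝ} (hy : y ∈ Set.Ioo (-1 : ℝ) 1) : 1 - y ^ 2 ≠ 0 := by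
  have : 0 < (1 - y) * (1 + y) := mul_pos (by linarith [hy.2]) (by linarith [hy.1])
  nlinarith

lemma continuousOn_deriv {β p K : ℝ} {f f' : ℝ → ℝ} (hf : IsBoundedOddProfile β p K f f') :
    ContinuousOn f' (Set.Ioo (-1) 1) :=
  fun y hy => (hf.hasDerivAt' y hy).continuousAt.continuousWithinAt

lemma iteratedDeriv_two {β p K : ℝ} {f f' : ℝ → ℝ} (hf : IsBoundedOddProfile β p K f f') {y : ℝ}
    (hy : y ∈ Set.Ioo (-1 : ℝ) 1) : iteratedDeriv 2 f y =
      (2 * β * y * f' y - (β * (1 - β) * f y + |f y| ^ (p - 1) * f y)) / (1 - y ^ 2) := by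
  have h : deriv f =ᶠ[𝓝 y] f' := by
    filter_upwards [isOpen_Ioo.mem_nhds hy] with z hz using (hf.hasDerivAt z hz).deriv
  rw [iteratedDeriv_succ, iteratedDeriv_one, h.deriv_eq, (hf.hasDerivAt' y hy).deriv]

lemma contDiffOn {β p K : ℝ} {f f' : ℝ → ℝ} (hp : 1 < p) (hf : IsBoundedOddProfile β p K f f') :
    ContDiffOn ℝ 2 f (Set.Ioo (-1) 1) := by
  have h1 : ContDiffOn ℝ 1 f' (Set.Ioo (-1) 1) := by
    rw [show (1 : WithTop ℕ∞) = 0 + 1 by simp, contDiffOn_succ_iff_deriv_of_isOpen isOpen_Ioo]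
    refine ⟨fun y hy => (hf.hasDerivAt' y hy).differentiableAt.differentiableWithinAt, by simp, ?_⟩
    rw [contDiffOn_zero]
    have : ContinuousOn (fun y => (2 * β * y * f' y - (β * (1 - β) * f y +
        |f y| ^ (p - 1) * f y)) / (1 - y ^ 2)) (Set.Ioo (-1) 1) := by
      have c := hf.continuousOn_deriv
      have c0 := hf.continuous
      have cN := (continuous_abs_rpow_mul (q := p - 1) (by linarith)).comp c0
      refine ContinuousOn.div ?_ (by fun_prop) fun y hy => one_sub_sq_ne hy
      exact ((by fun_prop : ContinuousOn (fun y => 2 * β * y) _).mul c).sub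
        ((by fun_prop : Continuous fun y => β * (1 - β) * f y).add cN).continuousOn
    exact this.congr fun y hy => (hf.hasDerivAt' y hy).deriv
  rw [show (2 : WithTop ℕ∞) = 1 + 1 by norm_num, contDiffOn_succ_iff_deriv_of_isOpen isOpen_Ioo]
  refine ⟨fun y hy => (hf.hasDerivAt y hy).differentiableAt.differentiableWithinAt, by simp, ?_⟩
  exact h1.congr fun y hy => (hf.hasDerivAt y hy).deriv

lemma isProfile {p K : ℝ} {f f' : ℝ → ℝ} (hp : 1 < p)
    (hf : IsBoundedOddProfile (2 / (p - 1)) p K f f') : IsProfile p (f' 0) f where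
  contDiffOn := hf.contDiffOn hp
  equation y hy := by
    rw [hf.iteratedDeriv_two hy, (hf.hasDerivAt y hy).deriv, mul_div_cancel₀ _ (one_sub_sq_ne hy)]
    ring
  init := hf.zero
  init_deriv := (hf.hasDerivAt 0 (by simp)).deriv

end IsBoundedOddProfile

/-- The exponent `β` is fixed by scaling: `β(p-1) = 2` makes the nonlinearity homogeneous of degree
`-β-2`, the same as second derivatives of `u`. -/
lemma powerNL_selfSimilar {β p : ℝ} (hβp : β * (p - 1) = 2) (f : ℝ → ℝ) {τ ρ : ℝ} (hρ : 0 < ρ) :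
    powerNL p (-1) (selfSimilar β f τ ρ)
      = -(selfSimilar β (fun y => |f y| ^ (p - 1) * f y) τ ρ / ρ / ρ) := by
  have h0 : 0 < ρ ^ (-β) := Real.rpow_pos_of_pos hρ _
  have h1 : (ρ ^ (-β)) ^ (p - 1) = 1 / ρ / ρ := by
    rw [← Real.rpow_mul hρ.le, neg_mul, hβp, Real.rpow_neg hρ.le, Real.rpow_two]
    field_simp
  simp only [powerNL, selfSimilar]
  rw [abs_mul, abs_of_pos h0, Real.mul_rpow h0.le (abs_nonneg _), h1]
  ring

/-- Kirchhoff's formula for `|x|^(-β) f(t/|x|)`, reduced to one space dimension. -/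
theorem selfSimilar_dAlembert {β p K : ℝ} {f f' : ℝ → ℝ} (hp : 1 < p)
    (hf : IsBoundedOddProfile β p K f f') {t r : ℝ} (hr : |t| < r) :
    r * selfSimilar β f t r = 1 / 2 * (∫ ρ in (r - t)..(r + t), ρ ^ (-β) * f' 0) +
      1 / 2 * ∫ τ in (0 : ℝ)..t, ∫ ρ in (r - (t - τ))..(r + (t - τ)),
        -(selfSimilar β (fun y => |f y| ^ (p - 1) * f y) τ ρ / ρ) := by
  have hc := hf.continuous
  have hc' := hf.continuousOn_deriv
  have hcN := (continuous_abs_rpow_mul (q := p - 1) (by linarith)).comp hc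
  have h := dAlembert_exterior_of_odd (v := fun τ ρ => ρ * selfSimilar β f τ ρ)
    (q := selfSimilar β (fun y => (1 - β) * f y + (1 - y) * f' y))
    (h := fun τ ρ => -(selfSimilar β (fun y => |f y| ^ (p - 1) * f y) τ ρ / ρ))
    (fun τ ρ hτ => hasDerivAt_mul_selfSimilar_outgoing hf.hasDerivAt hτ) ?_ ?_ ?_ ?_ ?_ hr
  · refine h.trans ?_
    simp [selfSimilar, hf.zero]
  · intro τ ρ hτ
    have hd : ∀ y ∈ Set.Ioo (-1 : ℝ) 1, HasDerivAt (fun y => (1 - β) * f y + (1 - y) * f' y)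
        ((1 - β) * f' y + (-1 * f' y + (1 - y) * ((2 * β * y * f' y -
          (β * (1 - β) * f y + |f y| ^ (p - 1) * f y)) / (1 - y ^ 2)))) y := fun y hy =>
      ((hf.hasDerivAt y hy).const_mul _).add
        (((hasDerivAt_id y).const_sub 1).mul (hf.hasDerivAt' y hy))
    -- For `g = (1-β) f + (1-y) f'` the profile equation factors as `β g + (1+y) g' = -|f|^(p-1) f`,
    -- mirroring the factorization of the one-dimensional wave operator.
    refine (hasDerivAt_selfSimilar_incoming hd hτ).congr_deriv ?_
    rw [neg_div']
    congr 1
    simp only [selfSimilar]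
    rw [← mul_neg]
    congr 1
    set y := τ / ρ
    have hy : y ∈ Set.Ioo (-1 : ℝ) 1 := div_mem_Ioo hτ
    have h1 : 1 - y ^ 2 ≠ 0 := IsBoundedOddProfile.one_sub_sq_ne hy
    generalize |f y| ^ (p - 1) * f y = N
    field_simp
    ring
  · exact continuousOn_selfSimilar (by fun_prop)
  · refine (ContinuousOn.div (continuousOn_selfSimilar hcN.continuousOn) (by fun_prop) ?_).neg
    exact fun z hz => ((abs_nonneg _).trans_lt hz).ne'
  · intro τ ρ
    simp only [selfSimilar, neg_div, hf.odd]
    ring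
  · intro τ ρ
    simp only [selfSimilar, neg_div, hf.odd, abs_neg]
    ring

namespace IsBoundedOddProfile

lemma contDiffOn_solution {β p K : ℝ} {f f' : ℝ → ℝ} (hp : 1 < p)
    (hf : IsBoundedOddProfile β p K f f') (R : ℝ) (hR : 0 ≤ R) :
    ContDiffOn ℝ 2 (Function.uncurry fun t (x : E3) => selfSimilar β f t ‖x‖) (extRegion R) := by
  refine (contDiffOn_selfSimilar_norm (hf.contDiffOn hp)).mono fun z hz => ?_
  have h : |z.1| + R < ‖z.2‖ := hz
  change |z.1| + 0 < ‖z.2‖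
  linarith

lemma isC2Solution {β p K : ℝ} {f f' : ℝ → ℝ} (hp : 1 < p) (hβp : β * (p - 1) = 2)
    (hf : IsBoundedOddProfile β p K f f') :
    IsC2Solution p (-1) 0 (fun t x => selfSimilar β f t ‖x‖) where
  contDiffOn := hf.contDiffOn_solution hp 0 le_rfl
  equation t x htx := by
    rw [add_zero] at htx
    have hr : 0 < ‖x‖ := (abs_nonneg t).trans_lt htx
    have hx : x ≠ 0 := norm_pos_iff.1 hr
    have hg : ∀ y ∈ Set.Ioo (-1 : ℝ) 1, HasDerivAt (fun y => -β * f y - y * f' y)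
        (-β * f' y - (1 * f' y + y * ((2 * β * y * f' y -
          (β * (1 - β) * f y + |f y| ^ (p - 1) * f y)) / (1 - y ^ 2)))) y := fun y hy =>
      ((hf.hasDerivAt y hy).const_mul _).sub ((hasDerivAt_id y).mul (hf.hasDerivAt' y hy))
    have hL := laplacian_comp_norm (G := fun ρ => selfSimilar β f t ρ)
      (G₁ := fun ρ => selfSimilar β (fun y => -β * f y - y * f' y) t ρ / ρ) hx
      (by
        filter_upwards [lt_mem_nhds htx] with ρ hρ
        exact hasDerivAt_selfSimilar_radius hf.hasDerivAt hρ)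
      ((hasDerivAt_selfSimilar_radius hg htx).div (hasDerivAt_id _) hr.ne')
    have hT : iteratedDeriv 2 (fun s => selfSimilar β f s ‖x‖) t = selfSimilar β (fun y =>
        (2 * β * y * f' y - (β * (1 - β) * f y + |f y| ^ (p - 1) * f y)) / (1 - y ^ 2)) t ‖x‖
          / ‖x‖ / ‖x‖ := by
      have h1 : deriv (fun s => selfSimilar β f s ‖x‖) =ᶠ[𝓝 t] fun s => selfSimilar β f' s ‖x‖ / ‖x‖ := by
        have : ∀ᶠ s in 𝓝 t, |s| < ‖x‖ := continuous_abs.continuousAt.eventually_lt_const htx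
        filter_upwards [this] with s hs
        exact (hasDerivAt_selfSimilar_time hf.hasDerivAt hs).deriv
      rw [iteratedDeriv_succ, iteratedDeriv_one, h1.deriv_eq]
      exact ((hasDerivAt_selfSimilar_time hf.hasDerivAt' htx).div_const _).deriv
    rw [hT, hL, powerNL_selfSimilar hβp f hr]
    simp only [selfSimilar]
    set y := t / ‖x‖
    have h1 : 1 - y ^ 2 ≠ 0 := one_sub_sq_ne (div_mem_Ioo htx)
    generalize |f y| ^ (p - 1) * f y = N
    generalize ‖x‖ ^ (-β) = A
    field_simp
    ring

lemma abs_selfSimilar_le {β K : ℝ} {g : ℝ → ℝ} (hg : ∀ y ∈ Set.Ioo (-1 : ℝ) 1, |g y| ≤ K)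
    {t ρ : ℝ} (h : |t| < ρ) : |selfSimilar β g t ρ| ≤ K * ρ ^ (-β) := by
  have hρ : 0 < ρ := (abs_nonneg t).trans_lt h
  have h0 : 0 < ρ ^ (-β) := Real.rpow_pos_of_pos hρ _
  rw [selfSimilar, abs_mul, abs_of_pos h0, mul_comm]
  exact mul_le_mul_of_nonneg_right (hg _ (div_mem_Ioo h)) h0.le

lemma measurable_selfSimilar {β p K : ℝ} {f f' : ℝ → ℝ} (hf : IsBoundedOddProfile β p K f f')
    (t : ℝ) : Measurable (selfSimilar β f t) := by
  have := hf.continuous.measurable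
  unfold selfSimilar
  fun_prop

lemma memX {β p K : ℝ} {f f' : ℝ → ℝ} (hp : 3 < p) (hβp : β * (p - 1) = 2)
    (hf : IsBoundedOddProfile β p K f f') {R : ℝ} (hR : 0 < R) (a b : ℝ) :
    MemX p R (Set.Icc a b) (fun t x => selfSimilar β f t ‖x‖) := by
  constructor
  · refine Measurable.aestronglyMeasurable ?_
    have := hf.continuous.measurable
    unfold Function.uncurry selfSimilar
    fun_prop
  -- Indeed `2βp = 4 + 2β`.
  · have hk : -β * (2 * p) < -3 := by nlinarith
    have hB := memLp_norm_rpow (k := -β) (q := 2 * p) hR (by linarith) hk K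
    set B := eLpNorm (fun x : E3 => K * ‖x‖ ^ (-β)) (ENNReal.ofReal (2 * p))
      (volume.restrict {x : E3 | R < ‖x‖}) with hBdef
    have hle : ∀ t, eLpNorm (fun x : E3 => selfSimilar β f t ‖x‖) (ENNReal.ofReal (2 * p))
        (volume.restrict (extSlice R t)) ≤ B := by
      intro t
      have hm : MeasurableSet (extSlice R t) := measurableSet_norm_gt (|t| + R)
      refine (eLpNorm_mono_ae_real (g := fun x : E3 => K * ‖x‖ ^ (-β)) ?_).trans
        (eLpNorm_mono_measure _ (Measure.restrict_mono ?_ le_rfl))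
      · filter_upwards [ae_restrict_mem hm] with x hx
        have h1 : |t| + R < ‖x‖ := hx
        exact abs_selfSimilar_le hf.bound (by linarith)
      · intro x hx
        have h1 : |t| + R < ‖x‖ := hx
        have := abs_nonneg t
        change R < ‖x‖
        linarith
    have hq : 0 ≤ 2 * p / (p - 3) := div_nonneg (by linarith) (by linarith)
    calc _ ≤ ∫⁻ _ in Set.Icc a b, B ^ (2 * p / (p - 3)) :=
          lintegral_mono fun t => ENNReal.rpow_le_rpow (hle t) hq
      _ = B ^ (2 * p / (p - 3)) * volume (Set.Icc a b) := by rw [setLIntegral_const]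
      _ < ⊤ := ENNReal.mul_lt_top (ENNReal.rpow_lt_top_of_nonneg hq hB.eLpNorm_ne_top) (by simp)

/-- Both first derivatives of `u` are `|x|^(-β-1)` times a bounded function of `t/|x|`. The
boundedness of `f'` up to the cone and `2β + 2 > 3` are both used here. -/
lemma tendsto_extEnergy {β p K : ℝ} {f f' : ℝ → ℝ} (hβ : 1 / 2 < β)
    (hf : IsBoundedOddProfile β p K f f') {R : ℝ} (hR : 0 < R) {l : Filter ℝ}
    [l.IsCountablyGenerated] (hl : Tendsto (fun t : ℝ => |t|) l atTop) :
    Tendsto (extEnergy R fun t x => selfSimilar β f t ‖x‖) l (𝓝 0) := by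
  have hK : 0 ≤ K := (abs_nonneg _).trans (hf.bound 0 (by simp))
  set L : ℝ := β * K + K with hL
  have hg : ∀ y ∈ Set.Ioo (-1 : ℝ) 1, |-β * f y - y * f' y| ≤ L := by
    intro y hy
    have h1 : |y| ≤ 1 := abs_le.2 ⟨hy.1.le, hy.2.le⟩
    calc |-β * f y - y * f' y| ≤ |-β * f y| + |y * f' y| := abs_sub _ _
      _ = β * |f y| + |y| * |f' y| := by
        rw [abs_mul, abs_mul, abs_neg, abs_of_pos (by linarith : 0 < β)]
      _ ≤ β * K + 1 * K := by
        have := hf.bound y hy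
        have := hf.bound' y hy
        gcongr
      _ = L := by rw [one_mul]
  have hg' : ∀ y ∈ Set.Ioo (-1 : ℝ) 1, |f' y| ≤ L := fun y hy =>
    (hf.bound' y hy).trans (by rw [hL]; nlinarith)
  have hlim := tendsto_setLIntegral_extSlice (k := -(2 * β) - 2) (by linarith) hR (2 * L ^ 2) hl
  refine tendsto_of_tendsto_of_tendsto_of_le_of_le tendsto_const_nhds hlim (fun t => zero_le)
    fun t => ?_
  refine setLIntegral_mono' (measurableSet_norm_gt (|t| + R)) fun x hx => ?_
  have hx1 : |t| + R < ‖x‖ := hx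
  have htx : |t| < ‖x‖ := by linarith
  have hr : 0 < ‖x‖ := (abs_nonneg t).trans_lt htx
  have hx0 : x ≠ 0 := norm_pos_iff.1 hr
  have key : ∀ z : ℝ, |z| ≤ L * ‖x‖ ^ (-β) → (z / ‖x‖) ^ 2 ≤ L ^ 2 * ‖x‖ ^ (-(2 * β) - 2) := by
    intro z hz
    have e : ‖x‖ ^ (-(2 * β) - 2) = (‖x‖ ^ (-β)) ^ 2 / ‖x‖ ^ 2 := by
      rw [Real.rpow_sub hr, Real.rpow_two, ← Real.rpow_natCast (‖x‖ ^ (-β)), ← Real.rpow_mul hr.le]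
      congr 2
      push_cast; ring
    rw [e, div_pow, ← mul_div_assoc, ← mul_pow]
    have : z ^ 2 ≤ (L * ‖x‖ ^ (-β)) ^ 2 := sq_le_sq.2 (hz.trans (le_abs_self _))
    gcongr
  have e1 : ‖∇ (fun x : E3 => selfSimilar β f t ‖x‖) x‖ₑ ^ 2 = ENNReal.ofReal
      ((selfSimilar β (fun y => -β * f y - y * f' y) t ‖x‖ / ‖x‖) ^ 2) := by
    rw [← ofReal_norm, norm_gradient_comp_norm hx0
      (hasDerivAt_selfSimilar_radius hf.hasDerivAt htx), ← ENNReal.ofReal_pow (abs_nonneg _), sq_abs]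
  have e2 : ‖deriv (fun s => selfSimilar β f s ‖x‖) t‖ₑ ^ 2 = ENNReal.ofReal
      ((selfSimilar β f' t ‖x‖ / ‖x‖) ^ 2) := by
    rw [← ofReal_norm, (hasDerivAt_selfSimilar_time hf.hasDerivAt htx).deriv,
      ← ENNReal.ofReal_pow (norm_nonneg _), Real.norm_eq_abs, sq_abs]
  rw [e1, e2, ← ENNReal.ofReal_add (sq_nonneg _) (sq_nonneg _)]
  refine ENNReal.ofReal_le_ofReal ?_
  have k1 := key _ (abs_selfSimilar_le hg htx)
  have k2 := key _ (abs_selfSimilar_le hg' htx)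
  linarith

/-- The velocity is a multiple of `|x|^(-β-1)`, square integrable at infinity for `β > 1/2` but in
general not at the origin, so it is cut off to zero inside the ball. The position is zero because `f
0 = 0`, which removes the cosine propagator from the Duhamel formula. -/
lemma isEnergyExtension {β p K : ℝ} {f f' : ℝ → ℝ} (hβ : 1 / 2 < β)
    (hf : IsBoundedOddProfile β p K f f') {R : ℝ} (hR : 0 < R) :
    IsEnergyExtension R (fun x => selfSimilar β f 0 ‖x‖) (fun x => selfSimilar β f' 0 ‖x‖ / ‖x‖)
      (fun _ => 0) (fun _ => 0)
      (fun x => (Set.Ioi R).indicator (fun ρ => selfSimilar β f' 0 ρ / ρ) ‖x‖) where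
  hdot1 := ⟨by simp, by simp, fun φ _ _ e => by simp⟩
  memLp := by
    have h := memLp_norm_rpow (k := -β - 1) (q := 2) hR (by norm_num) (by linarith) (f' 0)
    rw [← memLp_indicator_iff_restrict (measurableSet_norm_gt R)] at h
    have e : ENNReal.ofReal 2 = 2 := by simp
    rw [e] at h
    refine h.ae_eq (ae_of_all _ fun x => ?_)
    beta_reduce
    by_cases hx : R < ‖x‖
    · rw [Set.indicator_of_mem (show x ∈ {x : E3 | R < ‖x‖} from hx),
        Set.indicator_of_mem (show ‖x‖ ∈ Set.Ioi R from hx), selfSimilar, zero_div,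
        Real.rpow_sub_one (hR.trans hx).ne']
      ring
    · rw [Set.indicator_of_notMem (show x ∉ {x : E3 | R < ‖x‖} from hx),
        Set.indicator_of_notMem (show ‖x‖ ∉ Set.Ioi R from hx)]
  eq_left := ae_of_all _ fun x _ => by simp [selfSimilar, hf.zero]
  eq_right := ae_of_all _ fun x hx => by
    rw [Set.indicator_of_mem (show ‖x‖ ∈ Set.Ioi R from hx)]

lemma sinProp_initialVelocity {β : ℝ} {f' : ℝ → ℝ} {R : ℝ} (hR : 0 < R) {t : ℝ} {x : E3}
    (htx : |t| + R < ‖x‖) :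
    sinProp t (fun x => (Set.Ioi R).indicator (fun ρ => selfSimilar β f' 0 ρ / ρ) ‖x‖) x
      = 1 / (2 * ‖x‖) * ∫ ρ in (‖x‖ - t)..(‖x‖ + t), ρ ^ (-β) * f' 0 := by
  have hpos : ∀ ρ ∈ Set.Icc (‖x‖ - |t|) (‖x‖ + |t|), R < ρ := fun ρ hρ => by linarith [hρ.1]
  have hmem : ∀ ρ ∈ Set.uIcc (‖x‖ - t) (‖x‖ + t), R < ρ := by
    intro ρ hρ
    have h1 := hρ.1
    have : ‖x‖ - |t| ≤ min (‖x‖ - t) (‖x‖ + t) :=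
      le_min (by linarith [le_abs_self t]) (by linarith [neg_abs_le t])
    linarith
  have heq : Set.EqOn ((Set.Ioi R).indicator fun ρ => selfSimilar β f' 0 ρ / ρ)
      (fun ρ => ρ ^ (-β) * f' 0 / ρ) (Set.Ioi R) := fun ρ hρ => by
    rw [Set.indicator_of_mem hρ, selfSimilar, zero_div]
  rw [sinProp_radial (H := (Set.Ioi R).indicator fun ρ => selfSimilar β f' 0 ρ / ρ) ?_
    (by linarith) ?_]
  · congr 1
    refine intervalIntegral.integral_congr fun ρ hρ => ?_
    have h := hmem ρ hρ
    have : ρ ≠ 0 := (hR.trans h).ne'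
    rw [heq h]
    field_simp
  · refine Measurable.indicator ?_ measurableSet_Ioi
    simp only [selfSimilar, zero_div]
    fun_prop
  · refine ContinuousOn.congr ?_ (heq.mono fun ρ hρ => hpos ρ hρ)
    have hne : ∀ ρ ∈ Set.Icc (‖x‖ - |t|) (‖x‖ + |t|), ρ ≠ 0 := fun ρ hρ =>
      (hR.trans (hpos ρ hρ)).ne'
    refine ContinuousOn.div (ContinuousOn.mul ?_ continuousOn_const) continuousOn_id hne
    exact continuousOn_id.rpow_const fun ρ hρ => Or.inl (hne ρ hρ)

lemma duhamel_selfSimilar {β p K : ℝ} {f f' : ℝ → ℝ} (hp : 1 < p) (hβp : β * (p - 1) = 2)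
    (hf : IsBoundedOddProfile β p K f f') {R : ℝ} (hR : 0 < R) {t : ℝ} {x : E3}
    (htx : |t| + R < ‖x‖) :
    duhamel p (-1) R (fun t x => selfSimilar β f t ‖x‖) t x
      = 1 / (2 * ‖x‖) * ∫ τ in (0 : ℝ)..t, ∫ ρ in (‖x‖ - (t - τ))..(‖x‖ + (t - τ)),
        -(selfSimilar β (fun y => |f y| ^ (p - 1) * f y) τ ρ / ρ) := by
  rw [duhamel, ← intervalIntegral.integral_const_mul]
  refine intervalIntegral.integral_congr fun τ hτ => ?_
  -- Hence the sphere of radius `|t - τ|` about `x` lies in the slice `|y| > |τ| + R`, where the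
  -- cutoff equals one.
  have hsum : |t - τ| + |τ| = |t| := by
    rcases le_total 0 t with h | h
    · rw [Set.uIcc_of_le h] at hτ
      rw [abs_of_nonneg h, abs_of_nonneg hτ.1, abs_of_nonneg (by linarith [hτ.2])]; ring
    · rw [Set.uIcc_of_ge h] at hτ
      rw [abs_of_nonpos h, abs_of_nonpos hτ.2, abs_of_nonpos (by linarith [hτ.1])]; ring
  have hpos : ∀ ρ ∈ Set.Icc (‖x‖ - |t - τ|) (‖x‖ + |t - τ|), |τ| + R < ρ := fun ρ hρ => by
    linarith [hρ.1]
  have hmem : ∀ ρ ∈ Set.uIcc (‖x‖ - (t - τ)) (‖x‖ + (t - τ)), |τ| + R < ρ := by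
    intro ρ hρ
    have h1 := hρ.1
    have : ‖x‖ - |t - τ| ≤ min (‖x‖ - (t - τ)) (‖x‖ + (t - τ)) :=
      le_min (by linarith [le_abs_self (t - τ)]) (by linarith [neg_abs_le (t - τ)])
    linarith
  have hτ0 := abs_nonneg τ
  have hfun : (extSlice R τ).indicator (fun y : E3 => powerNL p (-1) (selfSimilar β f τ ‖y‖))
      = fun y => (Set.Ioi (|τ| + R)).indicator (fun ρ => powerNL p (-1) (selfSimilar β f τ ρ)) ‖y‖ := by
    ext y
    by_cases hy : |τ| + R < ‖y‖
    · rw [Set.indicator_of_mem (show y ∈ extSlice R τ from hy),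
        Set.indicator_of_mem (show ‖y‖ ∈ Set.Ioi (|τ| + R) from hy)]
    · rw [Set.indicator_of_notMem (show y ∉ extSlice R τ from hy),
        Set.indicator_of_notMem (show ‖y‖ ∉ Set.Ioi (|τ| + R) from hy)]
  rw [hfun, sinProp_radial ?_ (by linarith) ?_]
  · congr 1
    refine intervalIntegral.integral_congr fun ρ hρ => ?_
    have h := hmem ρ hρ
    have hρ0 : 0 < ρ := by linarith
    rw [Set.indicator_of_mem (show ρ ∈ Set.Ioi (|τ| + R) from h), powerNL_selfSimilar hβp f hρ0]
    field_simp
  · refine Measurable.indicator ?_ measurableSet_Ioi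
    have := hf.measurable_selfSimilar τ
    unfold powerNL
    fun_prop
  · have hcN := (continuous_abs_rpow_mul (q := p - 1) (by linarith)).comp hf.continuous
    have hne : ∀ ρ ∈ Set.Icc (‖x‖ - |t - τ|) (‖x‖ + |t - τ|), ρ ≠ 0 := fun ρ hρ => by
      have := hpos ρ hρ
      linarith
    have hc : ContinuousOn (fun ρ => -(selfSimilar β (fun y => |f y| ^ (p - 1) * f y) τ ρ / ρ / ρ))
        (Set.Icc (‖x‖ - |t - τ|) (‖x‖ + |t - τ|)) := by
      refine (ContinuousOn.div (ContinuousOn.div ?_ continuousOn_id hne) continuousOn_id hne).neg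
      refine (continuousOn_selfSimilar (β := β) hcN.continuousOn).comp (f := fun ρ => (τ, ρ))
        (by fun_prop) fun ρ hρ => ?_
      change |τ| < ρ
      linarith [hpos ρ hρ]
    refine hc.congr fun ρ hρ => ?_
    have h := hpos ρ hρ
    rw [Set.indicator_of_mem (show ρ ∈ Set.Ioi (|τ| + R) from h),
      powerNL_selfSimilar hβp f (by linarith)]

lemma isWeaklyNonRadiative {β p K : ℝ} {f f' : ℝ → ℝ} (hp : 3 < p) (hβ : 1 / 2 < β)
    (hβp : β * (p - 1) = 2) (hf : IsBoundedOddProfile β p K f f') {R : ℝ} (hR : 0 < R) :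
    IsWeaklyNonRadiative p (-1) R (fun x => selfSimilar β f 0 ‖x‖)
      (fun x => selfSimilar β f' 0 ‖x‖ / ‖x‖) (fun t x => selfSimilar β f t ‖x‖) where
  contDiffOn := (hf.contDiffOn_solution (by linarith) R hR.le).of_le (by norm_num)
  memHR := ⟨_, _, _, hf.isEnergyExtension hβ hR⟩
  exterior := by
    refine ⟨hf.memX hp hβp hR, _, _, _, hf.isEnergyExtension hβ hR, fun t => ae_of_all _ fun x htx => ?_⟩
    have htx' : |t| < ‖x‖ := by linarith
    have hr : 0 < ‖x‖ := (abs_nonneg t).trans_lt htx'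
    have hcos : cosProp t (fun _ : E3 => (0 : ℝ)) (fun _ => 0) x = 0 := by
      simp [cosProp, sphereMean]
    have h := selfSimilar_dAlembert (by linarith) hf htx'
    rw [linProp, hcos, zero_add, sinProp_initialVelocity hR htx,
      duhamel_selfSimilar (by linarith) hβp hf hR htx, ← mul_add]
    rw [← mul_add] at h
    field_simp
    linarith
  tendsto_atTop := hf.tendsto_extEnergy hβ hR tendsto_abs_atTop_atTop
  tendsto_atBot := hf.tendsto_extEnergy hβ hR tendsto_abs_atBot_atTop

end IsBoundedOddProfile

/-! ### Assembly of the solution. -/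

theorem theorem1p1 (p : ℝ) (hp3 : 3 < p) (hp5 : p < 5) :
    ∃ (u : ℝ → E3 → ℝ) (u₁ : E3 → ℝ),
      IsC2Solution p (-1) 0 u ∧ IsRadialOn 0 u ∧
      (∀ x : E3, x ≠ 0 → u 0 x = 0 ∧ HasDerivAt (fun t => u t x) (u₁ x) 0) ∧
      (∃ x : E3, x ≠ 0 ∧ u₁ x ≠ 0) ∧
      (∀ R : ℝ, 0 < R → IsWeaklyNonRadiative p (-1) R (u 0) u₁ u) ∧
      (∀ R : ℝ, 0 < R → pairingHR R (u 0) u₁ (fun x => 1 / ‖x‖) (fun _ => 0) = 0) ∧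
      (∃ (a : ℝ) (f : ℝ → ℝ), 0 < a ∧ IsProfile p a f ∧
        ∀ (t : ℝ) (x : E3), |t| < ‖x‖ → u t x = ‖x‖ ^ (-(2 / (p - 1))) * f (t / ‖x‖)) := by
  set β : ℝ := 2 / (p - 1) with hβdef
  have hβp : β * (p - 1) = 2 := div_mul_cancel₀ _ (by linarith)
  have hβ : 1 / 2 < β := by
    rw [hβdef, div_lt_div_iff₀ (by norm_num) (by linarith)]; linarith
  have hβ1 : β < 1 := by
    rw [hβdef, div_lt_one (by linarith)]; linarith
  obtain ⟨f, f', K, hc, hodd, hpos, h⟩ :=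
    exists_bounded_odd_profile (β := β) (p := p) (by linarith) hβ1 (by linarith)
  have hf : IsBoundedOddProfile β p K f f' :=
    ⟨hc, hodd, fun y hy => (h y hy).1, fun y hy => (h y hy).2.1, fun y hy => (h y hy).2.2.1,
      fun y hy => (h y hy).2.2.2⟩
  have h0 : ∀ x : E3, selfSimilar β f 0 ‖x‖ = 0 := fun x => by simp [selfSimilar, hf.zero]
  refine ⟨fun t x => selfSimilar β f t ‖x‖, fun x => selfSimilar β f' 0 ‖x‖ / ‖x‖,
    hf.isC2Solution (by linarith) hβp, fun t x y _ hxy => by simp only [hxy],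
    fun x hx => ⟨h0 x, hasDerivAt_selfSimilar_time hf.hasDerivAt (by simpa using hx)⟩, ?_,
    fun R hR => hf.isWeaklyNonRadiative hp3 hβ hβp hR, fun R _ => ?_,
    ⟨f' 0, f, hpos, hf.isProfile (by linarith), fun t x _ => rfl⟩⟩
  · have hn : ‖(EuclideanSpace.single 0 1 : E3)‖ = 1 := by simp
    refine ⟨EuclideanSpace.single 0 1, norm_ne_zero_iff.1 (by rw [hn]; exact one_ne_zero), ?_⟩
    simp only [hn, selfSimilar]
    simpa using hpos.ne'
  -- The first component of the data is identically zero, so its gradient vanishes, and the velocity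
  -- is paired with zero.
  · simp [pairingHR, h0, gradient]
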